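/- Let $H$ be a complex Hilbert space, $U\subseteq\mathbb{R}^2$ an open set of parameters $(y,t)$, and $\alpha,\beta\in\mathbb{C}$. Let $(e^{-zA})_{z\ge 0}$ be a bounded strongly continuous semigroup on $H$ and let $(-A,B(\zeta;y,t),C(y,t))$ be a family of linear systems with bounded operators $B(\zeta;y,t):\mathbb{C}\to H$ and $C(y,t):H\to\mathbb{C}$. Put $$\Phi(z,\zeta;y,t)=C(y,t)e^{-zA}B(\zeta;y,t),\qquad R_{z;y,t}=\int_z^\infty B(\zeta;y,t)C(y,t)e^{-\zeta A}\,d\zeta ,$$ $$K(z,\zeta;y,t)=-C(y,t)e^{-zA}(I+R_{z;y,t})^{-1}B(\zeta;y,t).$$ (The case $B(\zeta;y,t)=e^{-\zeta A}B(y)$, $C(y,t)=C(t)$ is included.) Let $\Omega=(0,\infty)\times U$, and call a normed-space-valued function $f(z,y,t)$ *admissible* if it is $C^\infty$ on $\Omega$ and for every order $k$, every $z_0>0$ and every point of $U$ there are a neighbourhood $N$ of that point and $g\in L^2(z_0,\infty)$ with $\|D^kf(z,y,t)\|\le g(z)$ for all $z>z_0$, $(y,t)\in N$. Suppose that * $(z,y,t)\mapsto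 C(y,t)e^{-zA}$ and $(\zeta,y,t)\mapsto B(\zeta;y,t)$ are admissible (in operator norm); * $I+R_{z;y,t}$ is invertible for all $(z,y,t)\in\Omega$; * for all $z,\zeta>0$ and $(y,t)\in U$, $$\beta\frac{\partial\Phi}{\partial y}+\frac{\partial^2\Phi}{\partial z^2}-\frac{\partial^2\Phi}{\partial\zeta^2}=0,\qquad \alpha\frac{\partial\Phi}{\partial t}+\frac{\partial^3\Phi}{\partial z^3}+\frac{\partial^3\Phi}{\partial\zeta^3}=0 .$$ Let $$u(z,y,t)=-2\frac{d}{dz}K(z,z;y,t),\qquad w(z,y,t)=-\frac{3\beta}{2}\frac{\partial K}{\partial y}(z,z;y,t),$$ $$L_0=-\Bigl(\beta\frac{\partial}{\partial y}+\frac{\partial^2}{\partial z^2}\Bigr),\qquad L_u=L_0+u,$$ $$M_0=\alpha\frac{\partial}{\partial t}+\frac{\partial^3}{\partial z^3},\qquad M_u=M_0-\frac32u\frac{\partial}{\partial z}-\frac34\frac{\partial u}{\partial z}+w,$$ and let $I+K$ be the Volterra-type operator $((I+K)\varphi)(z,y,t)=\varphi(z,y,t)+\int_z^\infty K(z,\eta;y,t)\varphi(\eta,y,t)\,d\eta$.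 Then: 1. $K$ is $C^\infty$ on $\{z,\zeta>0,\ (y,t)\in U\}$, and $u,w$ are $C^\infty$ on $\Omega$. For all $z,\zeta>0$ and $(y,t)\in U$ the Gelfand–Levitan equation $$\Phi(z,\zeta;y,t)+K(z,\zeta;y,t)+\int_z^\infty K(z,\eta;y,t)\Phi(\eta,\zeta;y,t)\,d\eta=0$$ holds with absolutely convergent integral, and $K(z,\cdot\,;y,t)$ is its only solution on $(z,\infty)$ in $L^2(z,\infty)$. 2. $L_0$, $M_0$ and $I+K$ map the space $\mathcal{W}$ of admissible complex-valued functions on $\Omega$ into itself (the integral defining $I+K$ being absolutely convergent on $\mathcal{W}$), and on $\mathcal{W}$ $$L_u(I+K)=(I+K)L_0,\qquad M_u(I+K)=(I+K)M_0 .$$ Moreover $I+K$ is invertible on $\mathcal{W}$, so that $L_u=(I+K)L_0(I+K)^{-1}$ and $M_u=(I+K)M_0(I+K)^{-1}$ on $\mathcal{W}$. 3. $L_0M_0=M_0L_0$ and $L_uM_u=M_uL_u$ on $C^\infty(\Omega)$. 4. $u$ satisfies the KP equation on $\Omega$: $$\frac{3\beta^2}{4}\frac{\partial^2u}{\partial y^2}+\frac{\partial}{\partial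 z}\Bigl(\alpha\frac{\partial u}{\partial t}+\frac14\frac{\partial^3u}{\partial z^3}-\frac32u\frac{\partial u}{\partial z}\Bigr)=0$$ (KPII when $\beta^2>0$). -/

import Mathlib

open Set MeasureTheory Topology
open scoped ContDiff

namespace KP

/-- A bounded strongly continuous one-parameter semigroup `T z = e^{-zA}`, `z ≥ 0`, of bounded
linear operators on `H` (so that `-A` is its generator). -/
structure BoundedSemigroup (H : Type*) [NormedAddCommGroup H] [InnerProductSpace ℂ H] where
  /-- the operator `e^{-zA}`; only the values at `z ≥ 0` are meaningful -/
  T : ℝ → H →L[ℂ] H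
  T_zero : T 0 = 1
  T_add : ∀ r s : ℝ, 0 ≤ r → 0 ≤ s → T (r + s) = T r ∘L T s
  continuous_orbit : ∀ h : H, ContinuousOn (fun s => T s h) (Ici 0)
  bounded : ∃ M : ℝ, ∀ s : ℝ, 0 ≤ s → ‖T s‖ ≤ M

/-- A `(y, t)`-family of continuous-time linear systems `(-A, B(ζ; y, t), C(y, t))` with state
space `H` and input and output space `ℂ`. The additive case is `B(ζ; y, t) = e^{-ζA} B(y, t)`. -/
structure LinearSystemFamily (H : Type*) [NormedAddCommGroup H] [InnerProductSpace ℂ H]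
    extends BoundedSemigroup H where
  /-- input operators, with arguments `ζ y t` -/
  B : ℝ → ℝ → ℝ → ℂ →L[ℂ] H
  /-- output operators, with arguments `y t` -/
  C : ℝ → ℝ → H →L[ℂ] ℂ

section System

variable {H : Type*} [NormedAddCommGroup H] [InnerProductSpace ℂ H]

/-- The output functional `C(y, t) e^{-zA}`. -/
noncomputable def LinearSystemFamily.out (S : LinearSystemFamily H) (z y t : ℝ) : H →L[ℂ] ℂ :=
  S.C y t ∘L S.T z

/-- The impulse response function `Φ(z, ζ; y, t) = C(y, t) e^{-zA} B(ζ; y, t)`. -/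
noncomputable def LinearSystemFamily.Φ (S : LinearSystemFamily H) (z ζ y t : ℝ) : ℂ :=
  (S.out z y t ∘L S.B ζ y t) 1

/-- `R_{z; y, t} = ∫_z^∞ B(ζ; y, t) C(y, t) e^{-ζA} dζ`, an operator on the state space. -/
noncomputable def LinearSystemFamily.R (S : LinearSystemFamily H) (z y t : ℝ) : H →L[ℂ] H :=
  ∫ ζ in Ioi z, S.B ζ y t ∘L S.out ζ y t

/-- `K(z, ζ; y, t) = -C(y, t) e^{-zA} (I + R_{z; y, t})⁻¹ B(ζ; y, t)`. -/
noncomputable def LinearSystemFamily.K (S : LinearSystemFamily H) (z ζ y t : ℝ) : ℂ :=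
  -(S.out z y t ∘L Ring.inverse (1 + S.R z y t) ∘L S.B ζ y t) 1

/-- `u(z, y, t) = -2 (d/dz) K(z, z; y, t)`. -/
noncomputable def LinearSystemFamily.u (S : LinearSystemFamily H) (z y t : ℝ) : ℂ :=
  -2 * deriv (fun s => S.K s s y t) z

/-- `w(z, y, t) = -(3β/2) (∂K/∂y)(z, z; y, t)`. -/
noncomputable def LinearSystemFamily.w (S : LinearSystemFamily H) (β : ℂ) (z y t : ℝ) : ℂ :=
  -(3 * β / 2) * deriv (fun y' => S.K z z y' t) y

end System

/-- `f` is smooth on `(0, ∞) × U`, and each of its derivatives is square integrable in `z`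
over `(z₀, ∞)` for every `z₀ > 0`, locally uniformly in the parameters `(y, t) ∈ U`. -/
def SmoothL2 {E : Type*} [NormedAddCommGroup E] [NormedSpace ℝ E] (U : Set (ℝ × ℝ))
    (f : ℝ → ℝ → ℝ → E) : Prop :=
  ContDiffOn ℝ ∞ (fun p : ℝ × ℝ × ℝ => f p.1 p.2.1 p.2.2) (Ioi (0 : ℝ) ×ˢ U) ∧
  ∀ k : ℕ, ∀ q ∈ U, ∀ z₀ : ℝ, 0 < z₀ → ∃ N ∈ 𝓝 q, ∃ g : ℝ → ℝ,
    MemLp g 2 (volume.restrict (Ioi z₀)) ∧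
    ∀ z : ℝ, z₀ < z → ∀ r ∈ N,
      ‖iteratedFDeriv ℝ k (fun p : ℝ × ℝ × ℝ => f p.1 p.2.1 p.2.2) (z, r)‖ ≤ g z

/-- The Volterra-type operator `I + K`. -/
noncomputable def volterra (K : ℝ → ℝ → ℝ → ℝ → ℂ) (φ : ℝ → ℝ → ℝ → ℂ) (z y t : ℝ) : ℂ :=
  φ z y t + ∫ η in Ioi z, K z η y t * φ η y t

/-- `L₀ = -(β ∂/∂y + ∂²/∂z²)`. -/
noncomputable def L₀ (β : ℂ) (θ : ℝ → ℝ → ℝ → ℂ) (z y t : ℝ) : ℂ :=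
  -(β * deriv (fun y' => θ z y' t) y + iteratedDeriv 2 (fun s => θ s y t) z)

/-- `L_u = -(β ∂/∂y + ∂²/∂z²) + u`. -/
noncomputable def L (β : ℂ) (u θ : ℝ → ℝ → ℝ → ℂ) (z y t : ℝ) : ℂ :=
  L₀ β θ z y t + u z y t * θ z y t

/-- `M₀ = α ∂/∂t + ∂³/∂z³`. -/
noncomputable def M₀ (α : ℂ) (θ : ℝ → ℝ → ℝ → ℂ) (z y t : ℝ) : ℂ :=
  α * deriv (fun t' => θ z y t') t + iteratedDeriv 3 (fun s => θ s y t) z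

/-- `M_u = α ∂/∂t + ∂³/∂z³ - (3/2) u ∂/∂z - (3/4) (∂u/∂z) + w`. -/
noncomputable def M (α : ℂ) (u w θ : ℝ → ℝ → ℝ → ℂ) (z y t : ℝ) : ℂ :=
  M₀ α θ z y t - 3 / 2 * u z y t * deriv (fun s => θ s y t) z
    - 3 / 4 * deriv (fun s => u s y t) z * θ z y t + w z y t * θ z y t

/-- Two functions of `(z, y, t)` agree on `(0, ∞) × U`. -/
def EqOnDomain (U : Set (ℝ × ℝ)) (f g : ℝ → ℝ → ℝ → ℂ) : Prop :=
  ∀ z y t : ℝ, 0 < z → (y, t) ∈ U → f z y t = g z y t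

/-- A function of `(z, y, t)` is smooth on `(0, ∞) × U`. -/
def SmoothOnDomain (U : Set (ℝ × ℝ)) (f : ℝ → ℝ → ℝ → ℂ) : Prop :=
  ContDiffOn ℝ ∞ (fun p : ℝ × ℝ × ℝ => f p.1 p.2.1 p.2.2) (Ioi (0 : ℝ) ×ˢ U)

/-- The left-hand side of the KP equation,
`(3β²/4) u_yy + ∂_z (α u_t + (1/4) u_zzz - (3/2) u u_z)`. -/
noncomputable def kpExpr (α β : ℂ) (u : ℝ → ℝ → ℝ → ℂ) (z y t : ℝ) : ℂ :=
  3 * β ^ 2 / 4 * iteratedDeriv 2 (fun y' => u z y' t) y +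
    deriv (fun s => α * deriv (fun t' => u s y t') t
      + 1 / 4 * iteratedDeriv 3 (fun s' => u s' y t) s
      - 3 / 2 * u s y t * deriv (fun s' => u s' y t) s) z

end KP

/-!
# Solitons of the KP equation from linear systems

Write `c(z) = C e^{-zA}` and `b(ζ) = B(ζ)`, and suppress the parameters `y, t`. The kernel
`K(z, ζ) = -ξ(z) b(ζ)` with `ξ(z) = c(z) (I + R_z)⁻¹` is separable, so that every integral operator
in the theorem can be expressed through the vector-valued integrals `tail f z = ∫_z^∞ f(η) dη`.

*Smoothness.* The class `Adm p` of smooth functions all of whose derivatives are dominated by `L^p`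
functions of `z` is stable under products, by Hölder's inequality (`SmoothLp.bilin`). It is sent
from `p = 1` to `p = ∞` by `tail` (`SmoothLp.tail`); the substitution `η = z + τ` permits
differentiation under the integral sign, the domination being locally uniform in `z` as well by a
one-dimensional Sobolev inequality. It is preserved for `p = ∞` by passage from `R` to `(I + R)⁻¹`
(`SmoothLp.inverse_one_add`). Hence `ξ` is admissible.

*The Gelfand-Levitan equation.* Since `R_z h = ∫_z^∞ b(η) c(η) h dη`, the identity `ξ (I + R) = c`
says that `I + K` maps `c(·) h` to `ξ(·) h` (`vol_xi_eval`); for `h = b(ζ)` this is the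
Gelfand-Levitan equation. If `k` solves the homogeneous equation, then the functional `∫ k c`
vanishes on the range of `I + R`, so it is zero, and so is `k` (`eq_zero_of_homogeneous`).

*Intertwining.* For a separable kernel, integration by parts turns `L_u (I + K) - (I + K) L₀` into
an integral operator, whose kernel is built from `b`, `ξ` and their derivatives: the boundary terms
cancel by the definition of `u` (`vol_opL₀_sub_opL_vol`). Applied to `c(·) b(ζ)`, the equation for
`Φ` in `y` shows that this kernel solves the homogeneous Gelfand-Levitan equation. So it vanishes
(`kernel_eq_L`), which gives `L_u (I + K) = (I + K) L₀` (`opL_vol`). The same argument works for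
`M_u`, where the boundary terms cancel by the definition of `u` and `w` and by `kernel_eq_L` on the
diagonal (`opM_vol_sub_vol_opM₀`, `kernel_eq_M`, `opM_vol`). The inverse of `I + K` is `I + J` with
`J(z, ζ) = c(z) (I + R_ζ)⁻¹ b(ζ)` (`vol_volInv`, `volInv_vol`).

*The KP equation.* As `w_z = (3β/4) u_y`, the commutator of `L_u` and `M_u` is multiplication by
a function, the `curvature` (`opL_opM_comm`). On admissible functions the commutator is conjugate to
that of `L₀` and `M₀`, which is zero. One admissible function without zeros, `e^{-z}`, suffices to
conclude that the curvature vanishes (`curvature_eq_zero`), so the commutator vanishes on all smooth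
functions. The derivative of the curvature in `z` is, up to sign, the left-hand side of the KP
equation (`kp_of_curvature`).
-/

namespace KP

/-! ### Functions dominated in `L^p` -/

section FunctionClasses

variable {E F : Type*} [NormedAddCommGroup E] [NormedAddCommGroup F]
  {p : ENNReal} {n : ℕ} {U : Set (ℝ × ℝ)}

/-- Over each half-line `(z₀, ∞)` with `z₀ > 0`, the function `f` is dominated by an `L^p` function
of `z`, locally uniformly in the parameters. -/
def LocDom (p : ENNReal) (U : Set (ℝ × ℝ)) (f : ℝ × ℝ × ℝ → E) : Prop :=
  ∀ a ∈ U, ∀ z₀ : ℝ, 0 < z₀ → ∃ N ∈ 𝓝 a, ∃ g : ℝ → ℝ,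
    MemLp g p (volume.restrict (Ioi z₀)) ∧ ∀ z : ℝ, z₀ < z → ∀ r ∈ N, ‖f (z, r)‖ ≤ g z

theorem isOpen_domain (hU : IsOpen U) : IsOpen (Ioi (0 : ℝ) ×ˢ U) := isOpen_Ioi.prod hU

theorem LocDom.of_norm_le (hU : IsOpen U) {f : ℝ × ℝ × ℝ → E} {g : ℝ × ℝ × ℝ → F}
    (hg : LocDom p U g) (h : ∀ x ∈ Ioi (0 : ℝ) ×ˢ U, ‖f x‖ ≤ ‖g x‖) : LocDom p U f := by
  intro a ha z₀ hz₀
  obtain ⟨N, hN, g, hg, hb⟩ := hg a ha z₀ hz₀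
  exact ⟨N ∩ U, Filter.inter_mem hN (hU.mem_nhds ha), g, hg, fun z hz r hr =>
    (h _ ⟨hz₀.trans hz, hr.2⟩).trans (hb z hz r hr.1)⟩

theorem LocDom.add {f g : ℝ × ℝ × ℝ → E} (hf : LocDom p U f) (hg : LocDom p U g) :
    LocDom p U (fun x => f x + g x) := by
  intro a ha z₀ hz₀
  obtain ⟨N, hN, f', hf', hb⟩ := hf a ha z₀ hz₀
  obtain ⟨N', hN', g', hg', hb'⟩ := hg a ha z₀ hz₀
  exact ⟨N ∩ N', Filter.inter_mem hN hN', f' + g', hf'.add hg', fun z hz r hr =>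
    (norm_add_le _ _).trans (add_le_add (hb z hz r hr.1) (hb' z hz r hr.2))⟩

variable [NormedSpace ℝ E] [NormedSpace ℝ F]

/-- `f` is of class `C^n` on `(0, ∞) × U`, and its derivatives up to order `n` are dominated
by `L^p` functions of `z`, locally uniformly in the parameters. For `p = 2` and all `n` this is
`SmoothL2`, for an uncurried function. -/
def SmoothLp (p : ENNReal) (n : ℕ) (U : Set (ℝ × ℝ)) (f : ℝ × ℝ × ℝ → E) : Prop :=
  ContDiffOn ℝ n f (Ioi (0 : ℝ) ×ˢ U) ∧ ∀ k ≤ n, LocDom p U (iteratedFDeriv ℝ k f)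

theorem LocDom.clm (L : E →L[ℝ] F) {f : ℝ × ℝ × ℝ → E} (hf : LocDom p U f) :
    LocDom p U (fun x => L (f x)) := by
  intro a ha z₀ hz₀
  obtain ⟨N, hN, f', hf', hb⟩ := hf a ha z₀ hz₀
  exact ⟨N, hN, fun z => ‖L‖ * f' z, hf'.const_mul _, fun z hz r hr =>
    (L.le_opNorm _).trans (mul_le_mul_of_nonneg_left (hb z hz r hr) (norm_nonneg _))⟩

theorem smoothL2_iff {f : ℝ → ℝ → ℝ → E} :
    SmoothL2 U f ↔ ∀ n, SmoothLp 2 n U (fun x : ℝ × ℝ × ℝ => f x.1 x.2.1 x.2.2) :=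
  ⟨fun h n => ⟨h.1.of_le (by exact_mod_cast le_top), fun k _ => h.2 k⟩,
    fun h => ⟨contDiffOn_infty.2 fun n => (h n).1, fun k => (h k).2 k le_rfl⟩⟩

theorem SmoothLp.locDom {f : ℝ × ℝ × ℝ → E} (hf : SmoothLp p n U f) : LocDom p U f := by
  intro a ha z₀ hz₀
  simpa using hf.2 0 (Nat.zero_le _) a ha z₀ hz₀

theorem SmoothLp.of_le {m : ℕ} {f : ℝ × ℝ × ℝ → E} (hf : SmoothLp p n U f) (h : m ≤ n) :
    SmoothLp p m U f :=
  ⟨hf.1.of_le (by exact_mod_cast h), fun k hk => hf.2 k (hk.trans h)⟩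

theorem smoothLp_zero_iff {f : ℝ × ℝ × ℝ → E} :
    SmoothLp p 0 U f ↔ ContinuousOn f (Ioi (0 : ℝ) ×ˢ U) ∧ LocDom p U f :=
  ⟨fun h => ⟨h.1.continuousOn, h.locDom⟩, fun h => ⟨contDiffOn_zero.2 h.1, fun k hk => by
    obtain rfl := Nat.le_zero.1 hk
    intro a ha z₀ hz₀
    simpa using h.2 a ha z₀ hz₀⟩⟩

theorem smoothLp_succ_iff (hU : IsOpen U) {f : ℝ × ℝ × ℝ → E} :
    SmoothLp p (n + 1) U f ↔ LocDom p U f ∧ DifferentiableOn ℝ f (Ioi (0 : ℝ) ×ˢ U) ∧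
      SmoothLp p n U (fderiv ℝ f) := by
  have hc := contDiffOn_succ_iff_fderiv_of_isOpen (𝕜 := ℝ) (n := n) (f := f) (isOpen_domain hU)
  constructor
  · intro h
    have h1 := hc.1 (by simpa using h.1)
    refine ⟨h.locDom, h1.1, h1.2.2, fun k hk => ?_⟩
    exact (h.2 (k + 1) (by omega)).of_norm_le hU fun x _ => norm_iteratedFDeriv_fderiv.le
  · rintro ⟨h0, h1, h2⟩
    refine ⟨by simpa using hc.2 ⟨h1, by simp, h2.1⟩, fun k hk => ?_⟩
    cases k with
    | zero => exact h0.of_norm_le hU fun x _ => by simp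
    | succ k =>
      exact (h2.2 k (by omega)).of_norm_le hU fun x _ => norm_iteratedFDeriv_fderiv.ge

theorem SmoothLp.congr (hU : IsOpen U) {f g : ℝ × ℝ × ℝ → E} (hf : SmoothLp p n U f)
    (h : EqOn f g (Ioi (0 : ℝ) ×ˢ U)) : SmoothLp p n U g := by
  refine ⟨hf.1.congr fun x hx => (h hx).symm, fun k hk => (hf.2 k hk).of_norm_le hU fun x hx => ?_⟩
  have : f =ᶠ[𝓝 x] g := h.eventuallyEq_of_mem ((isOpen_domain hU).mem_nhds hx)
  rw [(this.iteratedFDeriv ℝ k).self_of_nhds]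

theorem SmoothLp.add (hU : IsOpen U) {f g : ℝ × ℝ × ℝ → E} (hf : SmoothLp p n U f)
    (hg : SmoothLp p n U g) : SmoothLp p n U (fun x => f x + g x) := by
  refine ⟨hf.1.add hg.1, fun k hk => ((hf.2 k hk).add (hg.2 k hk)).of_norm_le hU fun x hx => ?_⟩
  have hx' := (isOpen_domain hU).mem_nhds hx
  have h1 : ContDiffAt ℝ k f x := (hf.1.contDiffAt hx').of_le (by exact_mod_cast hk)
  have h2 : ContDiffAt ℝ k g x := (hg.1.contDiffAt hx').of_le (by exact_mod_cast hk)
  exact (congrArg norm (iteratedFDeriv_add_apply h1 h2)).le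

theorem SmoothLp.clm (hU : IsOpen U) (L : E →L[ℝ] F) {f : ℝ × ℝ × ℝ → E} (hf : SmoothLp p n U f) :
    SmoothLp p n U (fun x => L (f x)) := by
  refine ⟨L.contDiff.comp_contDiffOn hf.1, fun k hk =>
    ((hf.2 k hk).clm (L.compContinuousMultilinearMapL ℝ _ _ _)).of_norm_le hU fun x hx => ?_⟩
  have h1 : ContDiffAt ℝ k f x :=
    (hf.1.contDiffAt ((isOpen_domain hU).mem_nhds hx)).of_le (by exact_mod_cast hk)
  exact (congrArg norm (L.iteratedFDeriv_comp_left h1 le_rfl)).le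

theorem SmoothLp.differentiableAt (hU : IsOpen U) {f : ℝ × ℝ × ℝ → E} (hf : SmoothLp p (n + 1) U f)
    {x : ℝ × ℝ × ℝ} (hx : x ∈ Ioi (0 : ℝ) ×ˢ U) : DifferentiableAt ℝ f x :=
  ((smoothLp_succ_iff hU).1 hf).2.1.differentiableAt ((isOpen_domain hU).mem_nhds hx)

end FunctionClasses

/-- Hölder's inequality for the classes `SmoothLp`. -/
theorem SmoothLp.bilin {p q r : ENNReal} [ENNReal.HolderTriple p q r] {U : Set (ℝ × ℝ)}
    (hU : IsOpen U) (n : ℕ) {E F G : Type*} [NormedAddCommGroup E] [NormedSpace ℝ E]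
    [NormedAddCommGroup F] [NormedSpace ℝ F] [NormedAddCommGroup G] [NormedSpace ℝ G]
    (B : E →L[ℝ] F →L[ℝ] G) {f : ℝ × ℝ × ℝ → E} {g : ℝ × ℝ × ℝ → F}
    (hf : SmoothLp p n U f) (hg : SmoothLp q n U g) :
    SmoothLp r n U (fun x => B (f x) (g x)) := by
  have key : ∀ k ≤ n, ∀ x ∈ Ioi (0 : ℝ) ×ˢ U, ‖iteratedFDeriv ℝ k (fun x => B (f x) (g x)) x‖ ≤
      ‖B‖ * ∑ i ∈ Finset.range (k + 1), (k.choose i : ℝ) * ‖iteratedFDeriv ℝ i f x‖ *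
        ‖iteratedFDeriv ℝ (k - i) g x‖ := by
    intro k hk x hx
    have hΩ := isOpen_domain hU
    have := B.norm_iteratedFDerivWithin_le_of_bilinear hf.1 hg.1 hΩ.uniqueDiffOn hx
      (n := k) (by exact_mod_cast hk)
    simpa only [iteratedFDerivWithin_of_isOpen _ hΩ hx] using this
  refine ⟨B.isBoundedBilinearMap.contDiff.comp_contDiffOn (hf.1.prodMk hg.1), fun k hk => ?_⟩
  intro a ha z₀ hz₀
  have hf' := fun i (hi : i ≤ n) => hf.2 i hi a ha z₀ hz₀
  have hg' := fun i (hi : i ≤ n) => hg.2 i hi a ha z₀ hz₀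
  choose! N hN f' hf₂ hNf using hf'
  choose! N' hN' g' hg₂ hNg using hg'
  have hV : {s | s ∈ U ∧ ∀ i ≤ n, s ∈ N i ∧ s ∈ N' i} ∈ 𝓝 a :=
    Filter.inter_mem (hU.mem_nhds ha) ((Set.finite_le_nat n).eventually_all.2 fun i hi =>
      Filter.inter_mem (hN i hi) (hN' i hi))
  refine ⟨_, hV, fun z => ‖B‖ * ∑ i ∈ Finset.range (k + 1),
      (k.choose i : ℝ) * (f' i z * g' (k - i) z), ?_, fun z hz s hs => ?_⟩
  · have hi : ∀ i ∈ Finset.range (k + 1),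
        MemLp (fun z => (k.choose i : ℝ) * (f' i z * g' (k - i) z)) r
          (volume.restrict (Ioi z₀)) := fun i hi => by
      have : i ≤ k := Nat.lt_succ_iff.1 (Finset.mem_range.1 hi)
      have h1 := hf₂ i (by omega)
      have h2 := hg₂ (k - i) (by omega)
      have h3 : MemLp (fun z => f' i z * g' (k - i) z) r (volume.restrict (Ioi z₀)) :=
        MemLp.mul h2 h1
      exact h3.const_mul _
    exact (memLp_finsetSum _ hi).const_mul _
  · refine (key k hk _ ⟨hz₀.trans hz, hs.1⟩).trans ?_
    refine mul_le_mul_of_nonneg_left (Finset.sum_le_sum fun i hi => ?_) B.opNorm_nonneg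
    have hik : i ≤ k := Nat.lt_succ_iff.1 (Finset.mem_range.1 hi)
    rw [mul_assoc]
    have h1 := hNf i (by omega) z hz s (hs.2 i (by omega)).1
    have h2 := hNg (k - i) (by omega) z hz s (hs.2 (k - i) (by omega)).2
    have := (norm_nonneg _).trans h1
    gcongr

/-! ### Integrals over half-lines depending on parameters -/

theorem continuousOn_slice {E : Type*} [NormedAddCommGroup E] {f : ℝ × ℝ × ℝ → E}
    {s : Set (ℝ × ℝ)} (hf : ContinuousOn f (Ioi (0 : ℝ) ×ˢ s)) {z₀ : ℝ}
    (hz₀ : 0 ≤ z₀) {a : ℝ × ℝ} (ha : a ∈ s) : ContinuousOn (fun η => f (η, a)) (Ioi z₀) :=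
  hf.comp (by fun_prop) fun _ hη => ⟨hz₀.trans_lt hη, ha⟩

section Tail

variable {E : Type*} [NormedAddCommGroup E] [NormedSpace ℝ E]
  {U : Set (ℝ × ℝ)} {n : ℕ} {f : ℝ × ℝ × ℝ → E} {x : ℝ × ℝ × ℝ}

/-- A one-dimensional Sobolev inequality: bounds for `h` and `h'` control `h` pointwise through
their integrals over an interval of length one. -/
theorem norm_le_setIntegral_of_hasDerivAt [CompleteSpace E] {h h' : ℝ → E} {g₀ g₁ : ℝ → ℝ}
    {z₀ a : ℝ} (hd : ∀ z, z₀ < z → HasDerivAt h (h' z) z) (hc : ContinuousOn h' (Ioi z₀))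
    (hg₀ : IntegrableOn g₀ (Ioi z₀)) (hg₁ : IntegrableOn g₁ (Ioi z₀))
    (hb₀ : ∀ z, z₀ < z → ‖h z‖ ≤ g₀ z) (hb₁ : ∀ z, z₀ < z → ‖h' z‖ ≤ g₁ z) (ha : z₀ < a) :
    ‖h a‖ ≤ ∫ w in Ioc a (a + 1), (g₀ w + g₁ w) := by
  have hsub : Ioc a (a + 1) ⊆ Ioi z₀ := fun w hw => ha.trans hw.1
  have hi₁ := hg₁.mono_set hsub
  have hi₀ := hg₀.mono_set hsub
  rw [integral_add hi₀ hi₁]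
  set I := ∫ w in Ioc a (a + 1), g₁ w
  have key : ∀ w ∈ Ioc a (a + 1), ‖h a‖ - I ≤ g₀ w := by
    intro w hw
    have huIcc : uIcc a w ⊆ Ioi z₀ := by
      rw [uIcc_of_le hw.1.le]; exact fun v hv => ha.trans_le hv.1
    have h1 := intervalIntegral.integral_eq_sub_of_hasDerivAt (fun v hv => hd v (huIcc hv))
      (hc.mono huIcc).intervalIntegrable
    have h2 : ‖∫ v in a..w, h' v‖ ≤ ∫ v in a..w, g₁ v :=
      intervalIntegral.norm_integral_le_of_norm_le hw.1.le
        (ae_of_all _ fun v hv => hb₁ v (ha.trans hv.1))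
        ((intervalIntegrable_iff_integrableOn_Ioc_of_le hw.1.le).2
          (hi₁.mono_set (Ioc_subset_Ioc_right hw.2)))
    have h3 : ∫ v in a..w, g₁ v ≤ I := by
      rw [intervalIntegral.integral_of_le hw.1.le]
      refine setIntegral_mono_set hi₁ ?_ (Ioc_subset_Ioc_right hw.2).eventuallyLE
      filter_upwards [ae_restrict_mem measurableSet_Ioc] with v hv
      exact (norm_nonneg _).trans (hb₁ v (hsub hv))
    rw [h1] at h2
    have h4 := hb₀ w (hsub hw)
    have h5 := norm_sub_norm_le (h a) (h w)
    rw [norm_sub_rev] at h5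
    linarith
  have := setIntegral_mono_on (integrableOn_const (by simp)) hi₀ measurableSet_Ioc key
  rw [setIntegral_const] at this
  simp at this
  linarith

/-- Averaging an integrable function over a window of fixed length gives an integrable function
of the position of the window, as a convolution with an indicator function. -/
theorem integrableOn_window {G : ℝ → ℝ} {z₀ L : ℝ} (hG : IntegrableOn G (Ioi z₀)) :
    IntegrableOn (fun τ => ∫ w in Ioc (z₀ + τ) (z₀ + τ + L), G w) (Ioi 0) := by
  have h1 : Integrable ((Ioi z₀).indicator G) := hG.integrable_indicator measurableSet_Ioi
  have h2 : Integrable ((Ico (-L - z₀) (-z₀)).indicator (1 : ℝ → ℝ)) :=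
    (integrable_indicator_iff measurableSet_Ico).2 (integrableOn_const (by simp))
  refine ((h1.integrable_convolution (ContinuousLinearMap.mul ℝ ℝ) h2).integrableOn).congr_fun
    (fun τ hτ => ?_) measurableSet_Ioi
  rw [convolution, ← integral_indicator measurableSet_Ioc]
  congr 1
  ext w
  have hτ : 0 < τ := hτ
  by_cases hw : w ∈ Ioc (z₀ + τ) (z₀ + τ + L)
  · rw [indicator_of_mem hw, indicator_of_mem (by rw [mem_Ioi]; linarith [hw.1]),
      indicator_of_mem (by constructor <;> linarith [hw.1, hw.2])]
    simp
  · rw [indicator_of_notMem hw, indicator_of_notMem (s := Ico (-L - z₀) (-z₀))]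
    · simp
    · exact fun h => hw (by constructor <;> linarith [h.1, h.2])

/-- The integral `∫_z^∞ f(η, y, t) dη`. -/
noncomputable def tail (f : ℝ × ℝ × ℝ → E) (x : ℝ × ℝ × ℝ) : E :=
  ∫ η in Ioi x.1, f (η, x.2)

theorem tail_eq_integral_Ioi_zero (f : ℝ × ℝ × ℝ → E) (x : ℝ × ℝ × ℝ) :
    tail f x = ∫ τ in Ioi (0 : ℝ), f (x.1 + τ, x.2) := by
  have := (measurePreserving_add_left volume x.1).setIntegral_preimage_emb
    (measurableEmbedding_addLeft x.1) (fun η => f (η, x.2)) (Ioi x.1)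
  simpa [tail] using this.symm

theorem tail_congr {g : ℝ × ℝ × ℝ → E} (h : EqOn f g (Ioi (0 : ℝ) ×ˢ U))
    (hx : x ∈ Ioi (0 : ℝ) ×ˢ U) : tail f x = tail g x :=
  setIntegral_congr_fun measurableSet_Ioi fun _ hη => h ⟨(mem_Ioi.1 hx.1).trans hη, hx.2⟩

/-- Functions of class `L^p` are `L^p` along the half-lines in `z`. -/
theorem SmoothLp.memLp {p : ENNReal} (hf : SmoothLp p n U f) (hx : x ∈ Ioi (0 : ℝ) ×ˢ U) :
    MemLp (fun η => f (η, x.2)) p (volume.restrict (Ioi x.1)) := by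
  obtain ⟨N, hN, g, hg, hb⟩ := hf.locDom x.2 hx.2 x.1 hx.1
  refine hg.mono' ((continuousOn_slice hf.1.continuousOn (le_of_lt hx.1) hx.2).aestronglyMeasurable
    measurableSet_Ioi) ?_
  filter_upwards [ae_restrict_mem measurableSet_Ioi] with η hη
  exact hb η hη _ (mem_of_mem_nhds hN)

theorem SmoothLp.integrableOn (hf : SmoothLp 1 n U f) (hx : x ∈ Ioi (0 : ℝ) ×ˢ U) :
    IntegrableOn (fun η => f (η, x.2)) (Ioi x.1) :=
  memLp_one_iff_integrable.1 (hf.memLp hx)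

theorem SmoothLp.integrableOn_add (hf : SmoothLp 1 n U f) (hx : x ∈ Ioi (0 : ℝ) ×ˢ U) :
    IntegrableOn (fun τ => f (x.1 + τ, x.2)) (Ioi 0) := by
  have := (measurePreserving_add_left volume x.1).integrableOn_comp_preimage
    (measurableEmbedding_addLeft x.1) (f := fun η => f (η, x.2)) (s := Ioi x.1)
  simpa [Function.comp_def] using this.2 (hf.integrableOn hx)

theorem LocDom.tail (hf : LocDom 1 U f) : LocDom ⊤ U (tail f) := by
  intro a ha z₀ hz₀
  obtain ⟨N, hN, g, hg, hb⟩ := hf a ha z₀ hz₀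
  have hg : IntegrableOn g (Ioi z₀) := memLp_one_iff_integrable.1 hg
  refine ⟨N, hN, fun _ => ∫ η in Ioi z₀, g η, memLp_top_const _, fun z hz r hr => ?_⟩
  refine (norm_integral_le_of_norm_le (hg.mono_set (Ioi_subset_Ioi hz.le)) ?_).trans
    (setIntegral_mono_set hg ?_ (Ioi_subset_Ioi hz.le).eventuallyLE)
  · filter_upwards [ae_restrict_mem measurableSet_Ioi] with η hη
    exact hb η (hz.trans hη) r hr
  · filter_upwards [ae_restrict_mem measurableSet_Ioi] with η hη
    exact (norm_nonneg _).trans (hb η hη r hr)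

/-- Differentiation under the integral sign, after the substitution `η = z + τ`, which makes the
domain of integration independent of `z`. -/
theorem SmoothLp.hasFDerivAt_tail [CompleteSpace E] (hU : IsOpen U) (hf : SmoothLp 1 2 U f)
    (hx : x ∈ Ioi (0 : ℝ) ×ˢ U) : HasFDerivAt (KP.tail f) (KP.tail (fderiv ℝ f) x) x := by
  have hΩ := isOpen_domain hU
  obtain ⟨z, a⟩ := x
  have hz : 0 < z := hx.1
  have ha : a ∈ U := hx.2
  have hf' := ((smoothLp_succ_iff hU).1 hf).2.2
  have hf'' := ((smoothLp_succ_iff hU).1 hf').2.2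
  obtain ⟨N₀, hN₀, g₀, hg₀, hb₀⟩ := hf'.locDom a ha (z / 2) (by positivity)
  obtain ⟨N₁, hN₁, g₁, hg₁, hb₁⟩ := hf''.locDom a ha (z / 2) (by positivity)
  have hg₀ : IntegrableOn g₀ (Ioi (z / 2)) := memLp_one_iff_integrable.1 hg₀
  have hg₁ : IntegrableOn g₁ (Ioi (z / 2)) := memLp_one_iff_integrable.1 hg₁
  have hfd : ∀ y ∈ Ioi (0 : ℝ) ×ˢ U, HasFDerivAt f (fderiv ℝ f y) y := fun y hy =>
    (hf.differentiableAt hU hy).hasFDerivAt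
  simp_rw [funext (tail_eq_integral_Ioi_zero f), tail_eq_integral_Ioi_zero]
  have hs : Ioo (z / 2) (2 * z) ×ˢ (N₀ ∩ N₁ ∩ U) ∈ 𝓝 (z, a) :=
    prod_mem_nhds (Ioo_mem_nhds (by linarith) (by linarith))
      (Filter.inter_mem (Filter.inter_mem hN₀ hN₁) (hU.mem_nhds ha))
  have hmem : ∀ y ∈ Ioo (z / 2) (2 * z) ×ˢ (N₀ ∩ N₁ ∩ U), ∀ τ ∈ Ioi (0 : ℝ),
      (y.1 + τ, y.2) ∈ Ioi (0 : ℝ) ×ˢ U := fun y hy τ hτ => by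
    refine ⟨?_, hy.2.2⟩
    have h1 := hy.1.1
    have h2 : 0 < τ := hτ
    change 0 < y.1 + τ
    linarith
  refine hasFDerivAt_integral_of_dominated_of_fderiv_le
    (F' := fun (y : ℝ × ℝ × ℝ) τ => fderiv ℝ f (y.1 + τ, y.2)) hs
    -- the Sobolev inequality on a window containing `[z' + τ, z' + τ + 1]` for all `z'` near `z`
    (bound := fun τ => ∫ w in Ioc (z / 2 + τ) (z / 2 + τ + (2 * z + 1)), (g₀ w + g₁ w))
    ?_ (hf.integrableOn_add hx) (hf'.integrableOn_add hx).aestronglyMeasurable ?_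
    (integrableOn_window (hg₀.add hg₁)) ?_
  · filter_upwards [hΩ.mem_nhds hx] with y hy
    exact (hf.integrableOn_add hy).aestronglyMeasurable
  · filter_upwards [ae_restrict_mem measurableSet_Ioi] with τ hτ y hy
    have hτ : 0 < τ := hτ
    have hy1 := hy.1.1
    have hy2 := hy.1.2
    have hd : ∀ w, z / 2 < w → HasDerivAt (fun w => fderiv ℝ f (w, y.2))
        (fderiv ℝ (fderiv ℝ f) (w, y.2) (1, 0)) w := fun w hw => by
      have hw' : (w, y.2) ∈ Ioi (0 : ℝ) ×ˢ U := ⟨by rw [mem_Ioi]; linarith, hy.2.2⟩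
      exact (hf'.differentiableAt hU hw').hasFDerivAt.comp_hasDerivAt w
        ((hasDerivAt_id w).prodMk (hasDerivAt_const w y.2))
    refine (norm_le_setIntegral_of_hasDerivAt hd ?_ hg₀ hg₁ (fun w hw => hb₀ w hw _ hy.2.1.1)
      (fun w hw => ?_) (by linarith)).trans (setIntegral_mono_set ?_ ?_ ?_)
    · exact (continuousOn_slice hf''.1.continuousOn (by positivity) hy.2.2).clm_apply
        continuousOn_const
    · refine ((fderiv ℝ (fderiv ℝ f) (w, y.2)).le_opNorm _).trans ?_
      have : ‖((1, 0) : ℝ × ℝ × ℝ)‖ = 1 := by simp [Prod.norm_def]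
      rw [this, mul_one]
      exact hb₁ w hw _ hy.2.1.2
    · exact (hg₀.add hg₁).mono_set fun w hw => by
        have := hw.1
        rw [mem_Ioi]; linarith
    · filter_upwards [ae_restrict_mem measurableSet_Ioc] with w hw
      have hw' : z / 2 < w := by linarith [hw.1]
      exact add_nonneg ((norm_nonneg _).trans (hb₀ w hw' _ hy.2.1.1))
        ((norm_nonneg _).trans (hb₁ w hw' _ hy.2.1.2))
    · exact (Ioc_subset_Ioc (by linarith) (by linarith)).eventuallyLE
  · filter_upwards [ae_restrict_mem measurableSet_Ioi] with τ hτ y hy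
    have h1 : HasFDerivAt (fun y : ℝ × ℝ × ℝ => (y.1 + τ, y.2))
        (ContinuousLinearMap.id ℝ (ℝ × ℝ × ℝ)) y := by
      simpa [Prod.add_def] using (hasFDerivAt_id y).add_const ((τ, 0) : ℝ × ℝ × ℝ)
    simpa [Function.comp_def] using (hfd _ (hmem y hy τ hτ)).comp y h1

end Tail

/-- `∫_z^∞ f` is smooth with bounded derivatives if the derivatives of `f` are dominated by
integrable functions: the derivatives of `∫_z^∞ f` are the functions `∫_z^∞ D^k f`. -/
theorem SmoothLp.tail {U : Set (ℝ × ℝ)} (hU : IsOpen U) (n : ℕ) {E : Type*} [NormedAddCommGroup E]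
    [NormedSpace ℝ E] [CompleteSpace E] {f : ℝ × ℝ × ℝ → E} (hf : SmoothLp 1 (n + 2) U f) :
    SmoothLp ⊤ n U (KP.tail f) := by
  have hd {m : ℕ} {E : Type _} [NormedAddCommGroup E] [NormedSpace ℝ E] [CompleteSpace E]
      {f : ℝ × ℝ × ℝ → E} (hf : SmoothLp 1 (m + 2) U f) (x) (hx : x ∈ Ioi (0 : ℝ) ×ˢ U) :=
    (hf.of_le (by omega)).hasFDerivAt_tail hU hx
  induction n generalizing E with
  | zero => exact smoothLp_zero_iff.2 ⟨fun x hx => (hd hf x hx).continuousAt.continuousWithinAt,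
      hf.locDom.tail⟩
  | succ n ih =>
    refine (smoothLp_succ_iff hU).2 ⟨hf.locDom.tail,
      fun x hx => (hd hf x hx).differentiableAt.differentiableWithinAt, ?_⟩
    exact (ih ((smoothLp_succ_iff hU).1 hf).2.2).congr hU fun x hx => (hd hf x hx).fderiv.symm

/-- Tail integrals are small near infinity, locally uniformly in the parameters. -/
theorem LocDom.tail_eventually_le {E : Type*} [NormedAddCommGroup E] [NormedSpace ℝ E]
    {U : Set (ℝ × ℝ)} {f : ℝ × ℝ × ℝ → E} (hf : LocDom 1 U f) {a : ℝ × ℝ} (ha : a ∈ U)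
    {ε : ℝ} (hε : 0 < ε) :
    ∃ N ∈ 𝓝 a, ∃ Z : ℝ, ∀ z, Z ≤ z → ∀ r ∈ N, ‖KP.tail f (z, r)‖ ≤ ε := by
  obtain ⟨N, hN, g, hg, hb⟩ := hf a ha 1 one_pos
  have hg : IntegrableOn g (Ioi 1) := memLp_one_iff_integrable.1 hg
  have h0 : Filter.Tendsto (fun z => ∫ η in Ioi z, g η) Filter.atTop (𝓝 0) :=
    tendsto_integral_Ioi_zero Filter.tendsto_id
  obtain ⟨Z, hZ⟩ := Filter.eventually_atTop.1 (h0.eventually_le_const hε)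
  refine ⟨N, hN, max Z 1, fun z hz r hr => ?_⟩
  refine (norm_integral_le_of_norm_le
    (hg.mono_set (Ioi_subset_Ioi ((le_max_right _ _).trans hz))) ?_).trans
    (hZ z ((le_max_left _ _).trans hz))
  filter_upwards [ae_restrict_mem measurableSet_Ioi] with η hη
  exact hb η (lt_of_le_of_lt ((le_max_right _ _).trans hz) hη) r hr

/-! ### Smoothness of the resolvent -/

theorem norm_inverse_one_add_le {A : Type*} [NormedRing A] {a : A} (ha : IsUnit (1 + a))
    (h : ‖a‖ ≤ 1 / 2) : ‖Ring.inverse (1 + a)‖ ≤ 2 * ‖(1 : A)‖ := by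
  have h1 : Ring.inverse (1 + a) = 1 - a * Ring.inverse (1 + a) := by
    rw [eq_sub_iff_add_eq, ← one_add_mul, Ring.mul_inverse_cancel _ ha]
  have h2 : ‖Ring.inverse (1 + a)‖ ≤ ‖(1 : A)‖ + 1 / 2 * ‖Ring.inverse (1 + a)‖ := by
    conv_lhs => rw [h1]
    exact (norm_sub_le _ _).trans (add_le_add le_rfl ((norm_mul_le _ _).trans
      (mul_le_mul_of_nonneg_right h (norm_nonneg _))))
  linarith

theorem continuousOn_inverse_one_add {A : Type*} [NormedRing A] [CompleteSpace A]
    {R : ℝ × ℝ × ℝ → A} {s : Set (ℝ × ℝ × ℝ)}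
    (hc : ContinuousOn R s) (hu : ∀ x ∈ s, IsUnit (1 + R x)) :
    ContinuousOn (fun x => Ring.inverse (1 + R x)) s := by
  intro x hx
  have h := NormedRing.inverse_continuousAt (hu x hx).unit
  rw [IsUnit.unit_spec] at h
  exact h.comp_continuousWithinAt (f := fun x => 1 + R x) (continuousWithinAt_const.add (hc x hx))

/-- The inverse of `1 + R` is bounded on `(z₀, ∞)`: near infinity because `R` is small there, and
on the remaining compact interval by continuity. -/
theorem locDom_inverse_one_add {A : Type*} [NormedRing A] [CompleteSpace A] {U : Set (ℝ × ℝ)}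
    {R : ℝ × ℝ × ℝ → A} (hU : IsOpen U)
    (hc : ContinuousOn R (Ioi (0 : ℝ) ×ˢ U))
    (hu : ∀ x ∈ Ioi (0 : ℝ) ×ˢ U, IsUnit (1 + R x))
    (h0 : ∀ a ∈ U, ∃ N ∈ 𝓝 a, ∃ Z : ℝ, ∀ z, Z ≤ z → ∀ r ∈ N, ‖R (z, r)‖ ≤ 1 / 2) :
    LocDom ⊤ U (fun x => Ring.inverse (1 + R x)) := by
  intro a ha z₀ hz₀
  obtain ⟨N, hN, Z, hZ⟩ := h0 a ha
  obtain ⟨δ, hδ, hball⟩ := Metric.nhds_basis_closedBall.mem_iff.1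
    (Filter.inter_mem hN (hU.mem_nhds ha))
  have hK : IsCompact (Icc z₀ Z ×ˢ Metric.closedBall a δ) :=
    isCompact_Icc.prod (isCompact_closedBall a δ)
  have hsub : Icc z₀ Z ×ˢ Metric.closedBall a δ ⊆ Ioi (0 : ℝ) ×ˢ U := fun x hx =>
    ⟨hz₀.trans_le hx.1.1, (hball hx.2).2⟩
  have hinv := continuousOn_inverse_one_add hc hu
  obtain ⟨C, hC⟩ := hK.exists_bound_of_continuousOn (hinv.mono hsub)
  refine ⟨Metric.closedBall a δ, Metric.closedBall_mem_nhds a hδ,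
    fun _ => max C (2 * ‖(1 : A)‖), memLp_top_const _, fun z hz r hr => ?_⟩
  rcases le_total z Z with h | h
  · exact (hC _ ⟨⟨hz.le, h⟩, hr⟩).trans (le_max_left _ _)
  · exact (norm_inverse_one_add_le (hu _ ⟨hz₀.trans hz, (hball hr).2⟩)
      (hZ z h r (hball hr).1)).trans (le_max_right _ _)

section Inverse

variable {A : Type*} [NormedRing A] [NormedAlgebra ℝ A] [CompleteSpace A] {U : Set (ℝ × ℝ)}
  {R : ℝ × ℝ × ℝ → A}

theorem hasFDerivAt_inverse_one_add {R' : ℝ × ℝ × ℝ →L[ℝ] A} {x : ℝ × ℝ × ℝ}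
    (hR : HasFDerivAt R R' x) (hx : IsUnit (1 + R x)) :
    HasFDerivAt (fun x => Ring.inverse (1 + R x))
      (-(ContinuousLinearMap.mulLeftRight ℝ A (Ring.inverse (1 + R x))
        (Ring.inverse (1 + R x))).comp R') x := by
  have h := hasFDerivAt_ringInverse (𝕜 := ℝ) hx.unit
  rw [← Ring.inverse_unit] at h
  rw [IsUnit.unit_spec] at h
  simpa [Function.comp_def] using h.comp x (hR.const_add 1)

/-- The resolvent `X = (1 + R)⁻¹` inherits smoothness with bounded derivatives, by
`D X = -X (D R) X`. -/
theorem SmoothLp.inverse_one_add (hU : IsOpen U) {n : ℕ} (hR : SmoothLp ⊤ n U R)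
    (hu : ∀ x ∈ Ioi (0 : ℝ) ×ˢ U, IsUnit (1 + R x))
    (h0 : ∀ a ∈ U, ∃ N ∈ 𝓝 a, ∃ Z : ℝ, ∀ z, Z ≤ z → ∀ r ∈ N, ‖R (z, r)‖ ≤ 1 / 2) :
    SmoothLp ⊤ n U (fun x => Ring.inverse (1 + R x)) := by
  have hdom := locDom_inverse_one_add hU hR.1.continuousOn hu h0
  induction n with
  | zero =>
    exact smoothLp_zero_iff.2 ⟨continuousOn_inverse_one_add hR.1.continuousOn hu, hdom⟩
  | succ n ih =>
    have hX := ih (hR.of_le (by omega))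
    have hd := fun x hx => hasFDerivAt_inverse_one_add
      (hR.differentiableAt hU hx).hasFDerivAt (hu x hx)
    refine (smoothLp_succ_iff hU).2 ⟨hdom, fun x hx =>
      (hd x hx).differentiableAt.differentiableWithinAt, ?_⟩
    have h1 := hX.bilin (r := ⊤) hU n (ContinuousLinearMap.mulLeftRight ℝ A) hX
    have h2 := (h1.bilin (r := ⊤) hU n (ContinuousLinearMap.compL ℝ (ℝ × ℝ × ℝ) A A)
      ((smoothLp_succ_iff hU).1 hR).2.2).clm hU (-ContinuousLinearMap.id ℝ _)
    refine h2.congr hU fun x hx => ?_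
    simpa using (hd x hx).fderiv.symm

end Inverse

/-! ### Directional derivatives on the domain -/

section Calculus

variable {E F G : Type*} [NormedAddCommGroup E] [NormedSpace ℝ E] [NormedAddCommGroup F]
  [NormedSpace ℝ F] [NormedAddCommGroup G] [NormedSpace ℝ G]
  {U : Set (ℝ × ℝ)} {v w : ℝ × ℝ × ℝ} {x : ℝ × ℝ × ℝ}

/-- `f` is smooth on `(0, ∞) × U`. -/
def Sm (U : Set (ℝ × ℝ)) (f : ℝ × ℝ × ℝ → E) : Prop := ContDiffOn ℝ ∞ f (Ioi (0 : ℝ) ×ˢ U)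

/-- The derivative of `f` in the direction `v` on `(0, ∞) × U`, extended by zero. With this
extension, the rules of calculus for functions smooth on `(0, ∞) × U` become equalities of
functions on the whole space. -/
noncomputable def pd (U : Set (ℝ × ℝ)) (v : ℝ × ℝ × ℝ) (f : ℝ × ℝ × ℝ → E) : ℝ × ℝ × ℝ → E :=
  (Ioi (0 : ℝ) ×ˢ U).indicator fun x => fderiv ℝ f x v

/-- The direction of `∂/∂z`. -/
abbrev ez : ℝ × ℝ × ℝ := (1, 0, 0)

/-- The direction of `∂/∂y`. -/
abbrev ey : ℝ × ℝ × ℝ := (0, 1, 0)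

/-- The direction of `∂/∂t`. -/
abbrev et : ℝ × ℝ × ℝ := (0, 0, 1)

theorem pd_apply {f : ℝ × ℝ × ℝ → E} (hx : x ∈ Ioi (0 : ℝ) ×ˢ U) :
    pd U v f x = fderiv ℝ f x v := indicator_of_mem hx _

theorem pd_of_notMem {f : ℝ × ℝ × ℝ → E} (hx : x ∉ Ioi (0 : ℝ) ×ˢ U) : pd U v f x = 0 :=
  indicator_of_notMem hx _

theorem Sm.differentiableAt (hU : IsOpen U) {f : ℝ × ℝ × ℝ → E} (hf : Sm U f)
    (hx : x ∈ Ioi (0 : ℝ) ×ˢ U) : DifferentiableAt ℝ f x :=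
  (ContDiffOn.contDiffAt hf ((isOpen_domain hU).mem_nhds hx)).differentiableAt (by simp)

theorem pd_congr (hU : IsOpen U) {f g : ℝ × ℝ × ℝ → E} (h : EqOn f g (Ioi (0 : ℝ) ×ˢ U)) :
    pd U v f = pd U v g := by
  refine indicator_congr fun x hx => ?_
  rw [(h.eventuallyEq_of_mem ((isOpen_domain hU).mem_nhds hx)).fderiv_eq]

theorem Sm.congr {f g : ℝ × ℝ × ℝ → E} (hf : Sm U f) (h : EqOn f g (Ioi (0 : ℝ) ×ˢ U)) : Sm U g :=
  ContDiffOn.congr hf fun _ hx => (h hx).symm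

theorem eqOn_pd {f : ℝ × ℝ × ℝ → E} :
    EqOn (fun x => fderiv ℝ f x v) (pd U v f) (Ioi (0 : ℝ) ×ˢ U) := fun _ hx => (pd_apply hx).symm

theorem Sm.pd (hU : IsOpen U) {f : ℝ × ℝ × ℝ → E} (hf : Sm U f) : Sm U (pd U v f) := by
  have h := (contDiffOn_infty_iff_fderiv_of_isOpen (isOpen_domain hU)).1 hf
  exact Sm.congr (h.2.clm_apply contDiffOn_const) eqOn_pd

theorem SmoothLp.pd (hU : IsOpen U) {p : ENNReal} {n : ℕ} {f : ℝ × ℝ × ℝ → E}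
    (hf : SmoothLp p (n + 1) U f) : SmoothLp p n U (pd U v f) :=
  (((smoothLp_succ_iff hU).1 hf).2.2.clm hU (ContinuousLinearMap.apply ℝ E v)).congr hU eqOn_pd

theorem sm_of_smoothLp {p : ENNReal} {f : ℝ × ℝ × ℝ → E} (hf : ∀ n, SmoothLp p n U f) : Sm U f :=
  contDiffOn_infty.2 fun n => (hf n).1

theorem Sm.add {f g : ℝ × ℝ × ℝ → E} (hf : Sm U f) (hg : Sm U g) : Sm U (fun x => f x + g x) :=
  ContDiffOn.add hf hg

theorem Sm.sub {f g : ℝ × ℝ × ℝ → E} (hf : Sm U f) (hg : Sm U g) : Sm U (fun x => f x - g x) :=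
  ContDiffOn.sub hf hg

theorem Sm.clm (L : E →L[ℝ] F) {f : ℝ × ℝ × ℝ → E} (hf : Sm U f) : Sm U (fun x => L (f x)) :=
  L.contDiff.comp_contDiffOn hf

theorem Sm.bilin (B : E →L[ℝ] F →L[ℝ] G) {f : ℝ × ℝ × ℝ → E} {g : ℝ × ℝ × ℝ → F}
    (hf : Sm U f) (hg : Sm U g) : Sm U (fun x => B (f x) (g x)) :=
  B.isBoundedBilinearMap.contDiff.comp_contDiffOn (ContDiffOn.prodMk hf hg)

/-- Pointwise rules of differentiation give rules for `pd`. -/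
theorem pd_eq_of_hasFDerivAt {f g : ℝ × ℝ × ℝ → E} {f' : ℝ × ℝ × ℝ → ℝ × ℝ × ℝ →L[ℝ] E}
    (h : ∀ x ∈ Ioi (0 : ℝ) ×ˢ U, HasFDerivAt f (f' x) x ∧ f' x v = g x)
    (h0 : ∀ x ∉ Ioi (0 : ℝ) ×ˢ U, g x = 0) : pd U v f = g := by
  ext1 x
  by_cases hx : x ∈ Ioi (0 : ℝ) ×ˢ U
  · rw [pd_apply hx, (h x hx).1.fderiv, (h x hx).2]
  · rw [pd_of_notMem hx, h0 x hx]

theorem pd_add (hU : IsOpen U) {f g : ℝ × ℝ × ℝ → E} (hf : Sm U f) (hg : Sm U g) :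
    pd U v (fun x => f x + g x) = fun x => pd U v f x + pd U v g x :=
  pd_eq_of_hasFDerivAt (fun _ hx => ⟨(hf.differentiableAt hU hx).hasFDerivAt.add
    (hg.differentiableAt hU hx).hasFDerivAt, by simp [pd_apply hx]⟩)
    fun _ hx => by simp [pd_of_notMem hx]

theorem pd_sub (hU : IsOpen U) {f g : ℝ × ℝ × ℝ → E} (hf : Sm U f) (hg : Sm U g) :
    pd U v (fun x => f x - g x) = fun x => pd U v f x - pd U v g x :=
  pd_eq_of_hasFDerivAt (fun _ hx => ⟨(hf.differentiableAt hU hx).hasFDerivAt.sub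
    (hg.differentiableAt hU hx).hasFDerivAt, by simp [pd_apply hx]⟩)
    fun _ hx => by simp [pd_of_notMem hx]

theorem pd_clm (hU : IsOpen U) (L : E →L[ℝ] F) {f : ℝ × ℝ × ℝ → E} (hf : Sm U f) :
    pd U v (fun x => L (f x)) = fun x => L (pd U v f x) :=
  pd_eq_of_hasFDerivAt (fun x hx => ⟨L.hasFDerivAt.comp x (hf.differentiableAt hU hx).hasFDerivAt,
    by simp [pd_apply hx]⟩) fun _ hx => by simp [pd_of_notMem hx]

theorem pd_bilin (hU : IsOpen U) (B : E →L[ℝ] F →L[ℝ] G) {f : ℝ × ℝ × ℝ → E} {g : ℝ × ℝ × ℝ → F}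
    (hf : Sm U f) (hg : Sm U g) :
    pd U v (fun x => B (f x) (g x)) = fun x => B (pd U v f x) (g x) + B (f x) (pd U v g x) :=
  pd_eq_of_hasFDerivAt (fun x hx => ⟨B.hasFDerivAt_of_bilinear
    (hf.differentiableAt hU hx).hasFDerivAt (hg.differentiableAt hU hx).hasFDerivAt, by
      simp [pd_apply hx, add_comm]⟩) fun _ hx => by simp [pd_of_notMem hx]

theorem pd_comm (hU : IsOpen U) {f : ℝ × ℝ × ℝ → E} (hf : Sm U f) (v w : ℝ × ℝ × ℝ) :
    pd U v (pd U w f) = pd U w (pd U v f) := by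
  have hΩ := isOpen_domain hU
  have h1 := ((contDiffOn_infty_iff_fderiv_of_isOpen hΩ).1 hf).2
  have key : ∀ v w, ∀ x ∈ Ioi (0 : ℝ) ×ˢ U,
      pd U v (pd U w f) x = fderiv ℝ (fderiv ℝ f) x v w := fun v w x hx => by
    rw [← pd_congr hU eqOn_pd, pd_apply hx]
    have h2 : DifferentiableAt ℝ (fderiv ℝ f) x :=
      (h1.contDiffAt (hΩ.mem_nhds hx)).differentiableAt (by simp)
    rw [fderiv_clm_apply h2 (differentiableAt_const w)]
    simp
  ext1 x
  by_cases hx : x ∈ Ioi (0 : ℝ) ×ˢ U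
  · rw [key v w x hx, key w v x hx]
    have h3 : ContDiffAt ℝ ∞ f x := ContDiffOn.contDiffAt hf (hΩ.mem_nhds hx)
    exact (h3.isSymmSndFDerivAt (by
      rw [minSmoothness_of_isRCLikeNormedField]
      exact WithTop.coe_le_coe.2 le_top)).eq v w
  · rw [pd_of_notMem hx, pd_of_notMem hx]

theorem hasDerivAt_line (hU : IsOpen U) {f : ℝ × ℝ × ℝ → E} (hf : Sm U f) {s : ℝ}
    (hx : x + s • v ∈ Ioi (0 : ℝ) ×ˢ U) :
    HasDerivAt (fun s : ℝ => f (x + s • v)) (pd U v f (x + s • v)) s := by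
  rw [pd_apply hx]
  have h : HasDerivAt (fun s : ℝ => x + s • v) v s := by
    simpa using ((hasDerivAt_id s).smul_const v).const_add x
  exact (hf.differentiableAt hU hx).hasFDerivAt.comp_hasDerivAt s h

theorem Sm.iterate_pd (hU : IsOpen U) {f : ℝ × ℝ × ℝ → E} (hf : Sm U f) (n : ℕ) :
    Sm U ((KP.pd U v)^[n] f) := by
  induction n with
  | zero => exact hf
  | succ n ih => rw [Function.iterate_succ_apply']; exact ih.pd hU

theorem iteratedDeriv_line (hU : IsOpen U) {f : ℝ × ℝ × ℝ → E} (hf : Sm U f) (n : ℕ) {s : ℝ}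
    (hx : x + s • v ∈ Ioi (0 : ℝ) ×ˢ U) :
    iteratedDeriv n (fun s : ℝ => f (x + s • v)) s = (pd U v)^[n] f (x + s • v) := by
  induction n generalizing s with
  | zero => simp
  | succ n ih =>
    rw [iteratedDeriv_succ, Function.iterate_succ_apply']
    have hc : ContinuousAt (fun s : ℝ => x + s • v) s := by fun_prop
    have h : iteratedDeriv n (fun s : ℝ => f (x + s • v)) =ᶠ[𝓝 s]
        fun s => (pd U v)^[n] f (x + s • v) := by
      filter_upwards [hc.preimage_mem_nhds ((isOpen_domain hU).mem_nhds hx)] with r hr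
      exact ih hr
    rw [h.deriv_eq]
    exact (hasDerivAt_line hU (hf.iterate_pd hU n) hx).deriv

theorem iteratedDeriv_z (hU : IsOpen U) {f : ℝ × ℝ × ℝ → E} (hf : Sm U f) (n : ℕ) {z y t : ℝ}
    (hx : (z, y, t) ∈ Ioi (0 : ℝ) ×ˢ U) :
    iteratedDeriv n (fun s : ℝ => f (s, y, t)) z = (pd U ez)^[n] f (z, y, t) := by
  have := iteratedDeriv_line (x := (0, y, t)) (v := ez) hU hf n (s := z) (by simpa using hx)
  simpa using this

theorem iteratedDeriv_y (hU : IsOpen U) {f : ℝ × ℝ × ℝ → E} (hf : Sm U f) (n : ℕ) {z y t : ℝ}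
    (hx : (z, y, t) ∈ Ioi (0 : ℝ) ×ˢ U) :
    iteratedDeriv n (fun s : ℝ => f (z, s, t)) y = (pd U ey)^[n] f (z, y, t) := by
  have := iteratedDeriv_line (x := (z, 0, t)) (v := ey) hU hf n (s := y) (by simpa using hx)
  simpa using this

theorem hasDerivAt_z (hU : IsOpen U) {f : ℝ × ℝ × ℝ → E} (hf : Sm U f) {z y t : ℝ}
    (hx : (z, y, t) ∈ Ioi (0 : ℝ) ×ˢ U) :
    HasDerivAt (fun s : ℝ => f (s, y, t)) (pd U ez f (z, y, t)) z := by
  have := hasDerivAt_line (x := (0, y, t)) (v := ez) hU hf (s := z) (by simpa using hx)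
  simpa using this

theorem hasDerivAt_y (hU : IsOpen U) {f : ℝ × ℝ × ℝ → E} (hf : Sm U f) {z y t : ℝ}
    (hx : (z, y, t) ∈ Ioi (0 : ℝ) ×ˢ U) :
    HasDerivAt (fun s : ℝ => f (z, s, t)) (pd U ey f (z, y, t)) y := by
  have := hasDerivAt_line (x := (z, 0, t)) (v := ey) hU hf (s := y) (by simpa using hx)
  simpa using this

theorem hasDerivAt_t (hU : IsOpen U) {f : ℝ × ℝ × ℝ → E} (hf : Sm U f) {z y t : ℝ}
    (hx : (z, y, t) ∈ Ioi (0 : ℝ) ×ˢ U) :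
    HasDerivAt (fun s : ℝ => f (z, y, s)) (pd U et f (z, y, t)) t := by
  have := hasDerivAt_line (x := (z, y, 0)) (v := et) hU hf (s := t) (by simpa using hx)
  simpa using this

/-! ### Derivatives and boundary terms of the tail integrals -/

theorem tendsto_tail (f : ℝ × ℝ × ℝ → E) (a : ℝ × ℝ) :
    Filter.Tendsto (fun z => tail f (z, a)) Filter.atTop (𝓝 0) :=
  tendsto_integral_Ioi_zero (f := fun η => f (η, a)) Filter.tendsto_id

variable [CompleteSpace E]

theorem eqOn_pd_tail (hU : IsOpen U) {f : ℝ × ℝ × ℝ → E} (hf : SmoothLp 1 2 U f) :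
    EqOn (pd U v (tail f)) (tail (pd U v f)) (Ioi (0 : ℝ) ×ˢ U) := by
  intro x hx
  have hf' := ((smoothLp_succ_iff hU).1 hf).2.2
  rw [pd_apply hx, (hf.hasFDerivAt_tail hU hx).fderiv, tail,
    ContinuousLinearMap.integral_apply (hf'.integrableOn hx)]
  exact tail_congr eqOn_pd hx

/-- A function which vanishes at infinity is recovered from its derivative in `z`. -/
theorem tail_eq_of_pd (hU : IsOpen U) {f g : ℝ × ℝ × ℝ → E} (hf : Sm U f)
    (hg : SmoothLp 1 0 U g) (h : ∀ x ∈ Ioi (0 : ℝ) ×ˢ U, pd U ez f x = - g x)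
    (hx : x ∈ Ioi (0 : ℝ) ×ˢ U)
    (h0 : Filter.Tendsto (fun z => f (z, x.2)) Filter.atTop (𝓝 0)) : tail g x = f x := by
  obtain ⟨z, y, t⟩ := x
  have hd : ∀ s ∈ Ici z, HasDerivAt (fun s => f (s, y, t)) (-g (s, y, t)) s := fun s hs => by
    have hs' : (s, y, t) ∈ Ioi (0 : ℝ) ×ˢ U := ⟨(mem_Ioi.1 hx.1).trans_le hs, hx.2⟩
    rw [← h _ hs']
    exact hasDerivAt_z hU hf hs'
  have := integral_Ioi_of_hasDerivAt_of_tendsto (hd z self_mem_Ici).continuousAt.continuousWithinAt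
    (fun s hs => hd s (mem_Ici_of_Ioi hs)) (hg.integrableOn hx).neg h0
  rw [integral_neg, zero_sub, neg_inj] at this
  exact this

theorem tail_pd_ez (hU : IsOpen U) {f : ℝ × ℝ × ℝ → E} (hf : ∀ n, SmoothLp 1 n U f)
    (hx : x ∈ Ioi (0 : ℝ) ×ˢ U) : tail (pd U ez f) x = - f x := by
  have hs := sm_of_smoothLp hf
  refine tail_eq_of_pd hU (f := fun x => - f x) (ContDiffOn.neg hs) ((hf 1).pd hU) ?_ hx ?_
  · intro x hx
    have := pd_clm (v := ez) hU (-ContinuousLinearMap.id ℝ E) hs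
    simpa using congrFun this x
  · obtain ⟨z, y, t⟩ := x
    rw [← neg_zero]
    refine (tendsto_zero_of_hasDerivAt_of_integrableOn_Ioi (a := z) (fun s hs => ?_)
      (((hf 1).pd (v := ez) hU).integrableOn hx) ((hf 0).integrableOn hx)).neg
    exact hasDerivAt_z hU (sm_of_smoothLp hf) ⟨(mem_Ioi.1 hx.1).trans hs, hx.2⟩

theorem eqOn_pd_ez_tail (hU : IsOpen U) {f : ℝ × ℝ × ℝ → E} (hf : ∀ n, SmoothLp 1 n U f) :
    EqOn (pd U ez (tail f)) (fun x => - f x) (Ioi (0 : ℝ) ×ˢ U) := fun _ hx =>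
  (eqOn_pd_tail hU (hf 2) hx).trans (tail_pd_ez hU hf hx)

end Calculus

/-! ### Admissible functions and the products in use -/

section Adm

variable {E F G : Type*} [NormedAddCommGroup E] [NormedSpace ℝ E] [NormedAddCommGroup F]
  [NormedSpace ℝ F] [NormedAddCommGroup G] [NormedSpace ℝ G]
  {U : Set (ℝ × ℝ)} {v : ℝ × ℝ × ℝ} {x : ℝ × ℝ × ℝ} {p q r : ENNReal}

/-- `f` is smooth, with all derivatives dominated by `L^p` functions of `z`. -/
def Adm (p : ENNReal) (U : Set (ℝ × ℝ)) (f : ℝ × ℝ × ℝ → E) : Prop := ∀ n, SmoothLp p n U f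

theorem Adm.sm {f : ℝ × ℝ × ℝ → E} (hf : Adm p U f) : Sm U f := sm_of_smoothLp hf

theorem Adm.pd (hU : IsOpen U) {f : ℝ × ℝ × ℝ → E} (hf : Adm p U f) : Adm p U (KP.pd U v f) :=
  fun n => (hf (n + 1)).pd hU

theorem Adm.congr (hU : IsOpen U) {f g : ℝ × ℝ × ℝ → E} (hf : Adm p U f)
    (h : EqOn f g (Ioi (0 : ℝ) ×ˢ U)) : Adm p U g := fun n => (hf n).congr hU h

theorem Adm.add (hU : IsOpen U) {f g : ℝ × ℝ × ℝ → E} (hf : Adm p U f) (hg : Adm p U g) :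
    Adm p U (fun x => f x + g x) := fun n => (hf n).add hU (hg n)

theorem Adm.clm (hU : IsOpen U) (L : E →L[ℝ] F) {f : ℝ × ℝ × ℝ → E} (hf : Adm p U f) :
    Adm p U (fun x => L (f x)) := fun n => (hf n).clm hU L

theorem Adm.neg (hU : IsOpen U) {f : ℝ × ℝ × ℝ → E} (hf : Adm p U f) :
    Adm p U (fun x => - f x) := hf.clm hU (-ContinuousLinearMap.id ℝ E)

theorem Adm.sub (hU : IsOpen U) {f g : ℝ × ℝ × ℝ → E} (hf : Adm p U f) (hg : Adm p U g) :
    Adm p U (fun x => f x - g x) := by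
  simpa only [sub_eq_add_neg] using hf.add hU (hg.neg hU)

theorem Adm.bilin [ENNReal.HolderTriple p q r] (hU : IsOpen U) (B : E →L[ℝ] F →L[ℝ] G)
    {f : ℝ × ℝ × ℝ → E} {g : ℝ × ℝ × ℝ → F} (hf : Adm p U f) (hg : Adm q U g) :
    Adm r U (fun x => B (f x) (g x)) := fun n => (hf n).bilin hU n B (hg n)

theorem Adm.tail [CompleteSpace E] (hU : IsOpen U) {f : ℝ × ℝ × ℝ → E} (hf : Adm 1 U f) :
    Adm ⊤ U (KP.tail f) := fun n => (hf (n + 2)).tail hU n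

theorem tail_add {f g : ℝ × ℝ × ℝ → E} (hf : Adm 1 U f) (hg : Adm 1 U g)
    (hx : x ∈ Ioi (0 : ℝ) ×ˢ U) :
    tail (fun x => f x + g x) x = tail f x + tail g x :=
  integral_add ((hf 0).integrableOn hx) ((hg 0).integrableOn hx)

theorem tail_sub {f g : ℝ × ℝ × ℝ → E} (hf : Adm 1 U f) (hg : Adm 1 U g)
    (hx : x ∈ Ioi (0 : ℝ) ×ˢ U) :
    tail (fun x => f x - g x) x = tail f x - tail g x :=
  integral_sub ((hf 0).integrableOn hx) ((hg 0).integrableOn hx)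

/-- The function `e^{-z}` is admissible. -/
theorem adm_exp (hU : IsOpen U) :
    Adm 2 U (fun x : ℝ × ℝ × ℝ => Complex.exp (-(x.1 : ℂ))) := by
  have hd : ∀ x : ℝ × ℝ × ℝ, HasFDerivAt (fun x : ℝ × ℝ × ℝ => Complex.exp (-(x.1 : ℂ)))
      (Complex.exp (-(x.1 : ℂ)) • -(Complex.ofRealCLM.comp (ContinuousLinearMap.fst ℝ ℝ (ℝ × ℝ))))
      x := fun x =>
    (Complex.ofRealCLM.comp (ContinuousLinearMap.fst ℝ ℝ (ℝ × ℝ))).hasFDerivAt.neg.cexp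
  have hdom : LocDom 2 U (fun x : ℝ × ℝ × ℝ => Complex.exp (-(x.1 : ℂ))) := by
    intro a _ z₀ _
    refine ⟨univ, Filter.univ_mem, fun z => Real.exp (-z), ?_, fun z _ r _ => ?_⟩
    · refine (memLp_two_iff_integrable_sq (by fun_prop)).2 ?_
      refine (integrableOn_exp_mul_Ioi (a := -2) (by norm_num) z₀).congr (ae_of_all _ fun z => ?_)
      beta_reduce
      rw [← Real.exp_nat_mul]
      push_cast
      ring_nf
    · simp [Complex.norm_exp]
  intro n
  induction n with
  | zero => exact smoothLp_zero_iff.2 ⟨fun x _ => (hd x).continuousAt.continuousWithinAt, hdom⟩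
  | succ n ih =>
    refine (smoothLp_succ_iff hU).2 ⟨hdom,
      fun x _ => (hd x).differentiableAt.differentiableWithinAt, ?_⟩
    refine (ih.clm hU ((ContinuousLinearMap.lsmul ℝ ℂ).flip
      (-(Complex.ofRealCLM.comp (ContinuousLinearMap.fst ℝ ℝ (ℝ × ℝ)))))).congr hU fun x _ => ?_
    rw [(hd x).fderiv]
    simp

end Adm

section Products

variable {H F G : Type*} [NormedAddCommGroup H] [NormedSpace ℂ H] [NormedAddCommGroup F]
  [NormedSpace ℂ F] [NormedAddCommGroup G] [NormedSpace ℂ G]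
  {U : Set (ℝ × ℝ)} {v : ℝ × ℝ × ℝ} {p : ℝ × ℝ × ℝ} {q r s : ENNReal}
  {φ ψ : ℝ × ℝ × ℝ → ℂ} {b : ℝ × ℝ × ℝ → H} {x : ℝ × ℝ × ℝ → H →L[ℂ] F}

/-- The evaluation `(L, h) ↦ L h`, as a real bilinear map. -/
noncomputable def evalB (H F : Type*) [NormedAddCommGroup H] [NormedSpace ℂ H]
    [NormedAddCommGroup F] [NormedSpace ℂ F] : (H →L[ℂ] F) →L[ℝ] H →L[ℝ] F :=
  ContinuousLinearMap.bilinearRestrictScalars ℝ (ContinuousLinearMap.id ℂ (H →L[ℂ] F))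

/-- The multiplication `(λ, h) ↦ λ • h`, as a real bilinear map. -/
noncomputable def smulB (H : Type*) [NormedAddCommGroup H] [NormedSpace ℂ H] :
    ℂ →L[ℝ] H →L[ℝ] H :=
  ContinuousLinearMap.bilinearRestrictScalars ℝ (ContinuousLinearMap.lsmul ℂ ℂ)

/-- The composition of operators, as a real bilinear map. -/
noncomputable def compB (H F G : Type*) [NormedAddCommGroup H] [NormedSpace ℂ H]
    [NormedAddCommGroup F] [NormedSpace ℂ F] [NormedAddCommGroup G] [NormedSpace ℂ G] :
    (F →L[ℂ] G) →L[ℝ] (H →L[ℂ] F) →L[ℝ] (H →L[ℂ] G) :=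
  ContinuousLinearMap.bilinearRestrictScalars ℝ (ContinuousLinearMap.compL ℂ H F G)

/-- The formation of operators of rank one, as a real bilinear map. -/
noncomputable def rankB (H F : Type*) [NormedAddCommGroup H] [NormedSpace ℂ H]
    [NormedAddCommGroup F] [NormedSpace ℂ F] : (H →L[ℂ] ℂ) →L[ℝ] F →L[ℝ] (H →L[ℂ] F) :=
  ContinuousLinearMap.bilinearRestrictScalars ℝ (ContinuousLinearMap.smulRightL ℂ H F)

theorem Sm.eval (hx : Sm U x) (hb : Sm U b) : Sm U (fun p => x p (b p)) := hx.bilin (evalB H F) hb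

theorem Sm.smul (hφ : Sm U φ) (hb : Sm U b) : Sm U (fun p => φ p • b p) := hφ.bilin (smulB H) hb

theorem Sm.mul (hφ : Sm U φ) (hψ : Sm U ψ) : Sm U (fun p => φ p * ψ p) := hφ.bilin (smulB ℂ) hψ

theorem Sm.const_mul (c : ℂ) (hφ : Sm U φ) : Sm U (fun p => c * φ p) :=
  hφ.clm (ContinuousLinearMap.mul ℝ ℂ c)

theorem Sm.neg (hφ : Sm U φ) : Sm U (fun p => - φ p) := ContDiffOn.neg hφ

theorem Sm.eval_const {c : ℝ × ℝ × ℝ → H →L[ℂ] F} (hc : Sm U c) (h : H) : Sm U (fun p => c p h) :=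
  hc.clm ((evalB H F).flip h)

theorem pd_eval (hU : IsOpen U) (hx : Sm U x) (hb : Sm U b) :
    pd U v (fun p => x p (b p)) = fun p => pd U v x p (b p) + x p (pd U v b p) :=
  pd_bilin hU (evalB H F) hx hb

theorem pd_eval_const (hU : IsOpen U) (hx : Sm U x) (h : H) :
    pd U v (fun p => x p h) = fun p => pd U v x p h := pd_clm hU ((evalB H F).flip h) hx

theorem pd_smul (hU : IsOpen U) (hφ : Sm U φ) (hb : Sm U b) :
    pd U v (fun p => φ p • b p) = fun p => pd U v φ p • b p + φ p • pd U v b p :=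
  pd_bilin hU (smulB H) hφ hb

theorem pd_mul (hU : IsOpen U) (hφ : Sm U φ) (hψ : Sm U ψ) :
    pd U v (fun p => φ p * ψ p) = fun p => pd U v φ p * ψ p + φ p * pd U v ψ p :=
  pd_bilin hU (smulB ℂ) hφ hψ

theorem pd_const_mul (hU : IsOpen U) (c : ℂ) (hφ : Sm U φ) :
    pd U v (fun p => c * φ p) = fun p => c * pd U v φ p :=
  pd_clm hU (ContinuousLinearMap.mul ℝ ℂ c) hφ

theorem pd_neg (hU : IsOpen U) (hφ : Sm U φ) :
    pd U v (fun p => - φ p) = fun p => - pd U v φ p := pd_clm hU (-ContinuousLinearMap.id ℝ ℂ) hφ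

theorem Adm.const_smul (hU : IsOpen U) (c : ℂ) (hb : Adm q U b) : Adm q U (fun p => c • b p) :=
  hb.clm hU (smulB H c)

theorem Adm.eval_const (hU : IsOpen U) (hx : Adm q U x) (h : H) : Adm q U (fun p => x p h) :=
  hx.clm hU ((evalB H F).flip h)

theorem Adm.smul [ENNReal.HolderTriple q r s] (hU : IsOpen U) (hφ : Adm q U φ) (hb : Adm r U b) :
    Adm s U (fun p => φ p • b p) := hφ.bilin hU (smulB H) hb

theorem Adm.eval [ENNReal.HolderTriple q r s] (hU : IsOpen U) (hx : Adm q U x) (hb : Adm r U b) :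
    Adm s U (fun p => x p (b p)) := hx.bilin hU (evalB H F) hb

theorem Adm.comp [ENNReal.HolderTriple q r s] (hU : IsOpen U) {y : ℝ × ℝ × ℝ → F →L[ℂ] G}
    (hy : Adm q U y) (hx : Adm r U x) : Adm s U (fun p => (y p).comp (x p)) :=
  hy.bilin hU (compB H F G) hx

/-- Products with tail integrals of admissible functions are admissible: the first factor is square
integrable and the second one is bounded, being the integral of a product of two square integrable
functions. -/
theorem Adm.eval_tail [CompleteSpace H] (hU : IsOpen U) (hx : Adm 2 U x) (hφ : Adm 2 U φ)
    (hb : Adm 2 U b) : Adm 2 U (fun p => x p (KP.tail (fun p => φ p • b p) p)) :=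
  hx.eval (r := ⊤) hU ((hφ.smul (s := 1) hU hb).tail hU)

/-- Integration by parts. The boundary term at infinity vanishes. -/
theorem tail_pd_smul [CompleteSpace H] (hU : IsOpen U) (hφ : Adm 2 U φ) (hb : Adm 2 U b)
    (hp : p ∈ Ioi (0 : ℝ) ×ˢ U) :
    tail (fun p => pd U ez φ p • b p) p
      = - (φ p • b p) - tail (fun p => φ p • pd U ez b p) p := by
  have h1 := tail_pd_ez hU (hφ.smul (s := 1) hU hb) hp
  rw [pd_smul hU hφ.sm hb.sm, tail_add ((hφ.pd hU).smul hU hb) (hφ.smul hU (hb.pd hU)) hp] at h1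
  exact eq_sub_of_add_eq h1

theorem pd_tail_smul [CompleteSpace H] (hU : IsOpen U) (hφ : Adm 2 U φ) (hb : Adm 2 U b)
    (hp : p ∈ Ioi (0 : ℝ) ×ˢ U) :
    pd U v (tail (fun p => φ p • b p)) p
      = tail (fun p => pd U v φ p • b p) p + tail (fun p => φ p • pd U v b p) p := by
  rw [eqOn_pd_tail hU (hφ.smul (s := 1) hU hb 2) hp, pd_smul hU hφ.sm hb.sm,
    tail_add ((hφ.pd hU).smul hU hb) (hφ.smul hU (hb.pd hU)) hp]

/-- The value of a functional on a tail integral is the integral of the values. -/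
theorem clm_tail_smul [CompleteSpace H] {ℓ : H →L[ℂ] ℂ} (hU : IsOpen U) (hφ : Adm 2 U φ)
    (hb : Adm 2 U b) (hp : p ∈ Ioi (0 : ℝ) ×ˢ U) :
    IntegrableOn (fun η => ℓ (b (η, p.2)) * φ (η, p.2)) (Ioi p.1) ∧
    ∫ η in Ioi p.1, ℓ (b (η, p.2)) * φ (η, p.2) = ℓ (tail (fun p => φ p • b p) p) := by
  have h := (hφ.smul (s := 1) hU hb 0).integrableOn hp
  have h1 := ℓ.integrable_comp h
  have h2 := ℓ.integral_comp_comm h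
  simp only [map_smul, smul_eq_mul, mul_comm (φ _)] at h1 h2
  exact ⟨h1, h2⟩

end Products

/-! ### The intertwining relations up to a remainder -/

section Intertwining

variable {H : Type*} [NormedAddCommGroup H] [NormedSpace ℂ H] [CompleteSpace H]
  {U : Set (ℝ × ℝ)} {p : ℝ × ℝ × ℝ} {φ ψ : ℝ × ℝ × ℝ → ℂ} {b : ℝ × ℝ × ℝ → H}
  {x : ℝ × ℝ × ℝ → H →L[ℂ] ℂ} {α β : ℂ}

/-- The Volterra operator with the separable kernel `-x(z) b(ζ)`, on uncurried functions. -/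
noncomputable def vol (x : ℝ × ℝ × ℝ → H →L[ℂ] ℂ) (b : ℝ × ℝ × ℝ → H) (φ : ℝ × ℝ × ℝ → ℂ)
    (p : ℝ × ℝ × ℝ) : ℂ := φ p - x p (tail (fun p => φ p • b p) p)

/-- The operator `L₀` on uncurried functions. -/
noncomputable def opL₀ (U : Set (ℝ × ℝ)) (β : ℂ) (φ : ℝ × ℝ × ℝ → ℂ) (p : ℝ × ℝ × ℝ) : ℂ :=
  -(β * pd U ey φ p + pd U ez (pd U ez φ) p)

/-- The operator `M₀` on uncurried functions. -/
noncomputable def opM₀ (U : Set (ℝ × ℝ)) (α : ℂ) (φ : ℝ × ℝ × ℝ → ℂ) (p : ℝ × ℝ × ℝ) : ℂ :=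
  α * pd U et φ p + pd U ez (pd U ez (pd U ez φ)) p

/-- The operator `L_u` on uncurried functions. -/
noncomputable def opL (U : Set (ℝ × ℝ)) (β : ℂ) (u φ : ℝ × ℝ × ℝ → ℂ) (p : ℝ × ℝ × ℝ) : ℂ :=
  opL₀ U β φ p + u p * φ p

/-- The operator `M_u` on uncurried functions. -/
noncomputable def opM (U : Set (ℝ × ℝ)) (α : ℂ) (u w φ : ℝ × ℝ × ℝ → ℂ) (p : ℝ × ℝ × ℝ) : ℂ :=
  opM₀ U α φ p - 3 / 2 * u p * pd U ez φ p - 3 / 4 * pd U ez u p * φ p + w p * φ p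

/-- The potential `u = -2 (d/dz) K(z, z)` of the kernel `K = -x(z) b(ζ)`. -/
noncomputable def potU (U : Set (ℝ × ℝ)) (x : ℝ × ℝ × ℝ → H →L[ℂ] ℂ) (b : ℝ × ℝ × ℝ → H)
    (p : ℝ × ℝ × ℝ) : ℂ := 2 * pd U ez (fun p => x p (b p)) p

/-- The potential `w = -(3β/2) (∂K/∂y)(z, z)` of the kernel `K = -x(z) b(ζ)`. -/
noncomputable def potW (U : Set (ℝ × ℝ)) (β : ℂ) (x : ℝ × ℝ × ℝ → H →L[ℂ] ℂ)
    (b : ℝ × ℝ × ℝ → H) (p : ℝ × ℝ × ℝ) : ℂ := 3 * β / 2 * pd U ey (fun p => x p (b p)) p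

theorem Adm.opL₀ (hU : IsOpen U) (hφ : Adm 2 U φ) : Adm 2 U (KP.opL₀ U β φ) :=
  (((hφ.pd hU).const_smul hU β).add hU ((hφ.pd hU).pd hU)).neg hU

theorem Adm.opM₀ (hU : IsOpen U) (hφ : Adm 2 U φ) : Adm 2 U (KP.opM₀ U α φ) :=
  ((hφ.pd hU).const_smul hU α).add hU (((hφ.pd hU).pd hU).pd hU)

theorem Adm.vol (hU : IsOpen U) (hx : Adm 2 U x) (hb : Adm 2 U b) (hφ : Adm 2 U φ) :
    Adm 2 U (KP.vol x b φ) := hφ.sub hU (hx.eval_tail hU hφ hb)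

/-- `(β∂_y + ∂_z²) x - u x`, the part of the remainder which falls on the first variable. -/
noncomputable def remL (U : Set (ℝ × ℝ)) (β : ℂ) (u : ℝ × ℝ × ℝ → ℂ) (x : ℝ × ℝ × ℝ → H →L[ℂ] ℂ)
    (p : ℝ × ℝ × ℝ) : H →L[ℂ] ℂ :=
  β • pd U ey x p + pd U ez (pd U ez x) p - u p • x p

/-- `(α∂_t + ∂_z³) x - (3/2) u ∂_z x - (3/4) (∂_z u) x + w x`, the part of the remainder which
falls on the first variable. -/
noncomputable def remM (U : Set (ℝ × ℝ)) (α : ℂ) (u w : ℝ × ℝ × ℝ → ℂ)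
    (x : ℝ × ℝ × ℝ → H →L[ℂ] ℂ) (p : ℝ × ℝ × ℝ) : H →L[ℂ] ℂ :=
  α • pd U et x p + pd U ez (pd U ez (pd U ez x)) p - (3 / 2 * u p) • pd U ez x p
    - (3 / 4 * pd U ez u p) • x p + w p • x p

/-- Differentiation of the lower limit of integration produces a boundary term. The two lemmas
which follow iterate this. -/
theorem pd_ez_eval_tail (hU : IsOpen U) (hx : Sm U x) (hφ : Adm 2 U φ) (hb : Adm 2 U b) :
    EqOn (pd U ez (fun p => x p (tail (fun p => φ p • b p) p)))
      (fun p => pd U ez x p (tail (fun p => φ p • b p) p) - φ p * x p (b p))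
      (Ioi (0 : ℝ) ×ˢ U) := by
  intro p hp
  have hs := hφ.smul (s := 1) hU hb
  rw [pd_eval hU hx (hs.tail hU).sm]
  beta_reduce
  rw [eqOn_pd_ez_tail hU hs hp]
  simp [sub_eq_add_neg]

theorem pd_ez_pd_ez_eval_tail (hU : IsOpen U) (hx : Sm U x) (hφ : Adm 2 U φ) (hb : Adm 2 U b) :
    EqOn (pd U ez (pd U ez (fun p => x p (tail (fun p => φ p • b p) p))))
      (fun p => pd U ez (pd U ez x) p (tail (fun p => φ p • b p) p) - φ p * pd U ez x p (b p)
        - pd U ez (fun p => φ p * x p (b p)) p) (Ioi (0 : ℝ) ×ˢ U) := by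
  intro p hp
  have hs := (hφ.smul (s := 1) hU hb).tail hU
  rw [pd_congr hU (pd_ez_eval_tail hU hx hφ hb),
    pd_sub hU ((hx.pd hU).eval hs.sm) (hφ.sm.mul (hx.eval hb.sm))]
  beta_reduce
  rw [pd_ez_eval_tail hU (hx.pd hU) hφ hb hp]

theorem pd_ez_pd_ez_pd_ez_eval_tail (hU : IsOpen U) (hx : Sm U x) (hφ : Adm 2 U φ)
    (hb : Adm 2 U b) :
    EqOn (pd U ez (pd U ez (pd U ez (fun p => x p (tail (fun p => φ p • b p) p)))))
      (fun p => pd U ez (pd U ez (pd U ez x)) p (tail (fun p => φ p • b p) p)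
        - φ p * pd U ez (pd U ez x) p (b p) - pd U ez (fun p => φ p * pd U ez x p (b p)) p
        - pd U ez (pd U ez (fun p => φ p * x p (b p))) p) (Ioi (0 : ℝ) ×ˢ U) := by
  intro p hp
  have hs := (hφ.smul (s := 1) hU hb).tail hU
  have h1 := hφ.sm.mul ((hx.pd (v := ez) hU).eval hb.sm)
  have h2 := hφ.sm.mul (hx.eval hb.sm)
  have h3 := ((hx.pd (v := ez) hU).pd (v := ez) hU).eval hs.sm
  rw [pd_congr hU (pd_ez_pd_ez_eval_tail hU hx hφ hb),
    pd_sub hU (h3.sub h1) (h2.pd hU), pd_sub hU h3 h1]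
  beta_reduce
  rw [pd_ez_eval_tail hU ((hx.pd hU).pd hU) hφ hb hp]

/-- The commutation defect of `L₀` and `L_u` with a separable Volterra operator is an integral
operator; the boundary terms cancel by the definition of `u`. -/
theorem vol_opL₀_sub_opL_vol (hU : IsOpen U) (hx : Adm 2 U x) (hb : Adm 2 U b) (hφ : Adm 2 U φ)
    (hp : p ∈ Ioi (0 : ℝ) ×ˢ U) :
    vol x b (opL₀ U β φ) p - opL U β (potU U x b) (vol x b φ) p =
      x p (tail (fun p => φ p • (pd U ez (pd U ez b) p - β • pd U ey b p)) p)
        - remL U β (potU U x b) x p (tail (fun p => φ p • b p) p) := by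
  have hs := hφ.smul (s := 1) hU hb
  have hv := (hx.eval_tail hU hφ hb).sm
  have hφz := hφ.pd (v := ez) hU
  have hbz := hb.pd (v := ez) hU
  have hφy := hφ.pd (v := ey) hU
  have hby := hb.pd (v := ey) hU
  -- the tail integrals on the left-hand side, after integration by parts
  have e1 : tail (fun p => opL₀ U β φ p • b p) p
      = - (β • tail (fun p => pd U ey φ p • b p) p)
        - tail (fun p => pd U ez (pd U ez φ) p • b p) p := by
    have h := tail_sub (((hφy.smul (s := 1) hU hb).const_smul hU β).neg hU)
      ((hφz.pd (v := ez) hU).smul (s := 1) hU hb) hp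
    convert h using 2
    · ext1 p
      simp only [opL₀, neg_smul, add_smul, mul_smul, neg_add, sub_eq_add_neg]
    · simp only [tail, integral_neg, integral_smul]
  have e2 : tail (fun p => φ p • (pd U ez (pd U ez b) p - β • pd U ey b p)) p
      = tail (fun p => φ p • pd U ez (pd U ez b) p) p
        - β • tail (fun p => φ p • pd U ey b p) p := by
    have h := tail_sub (hφ.smul (s := 1) hU (hbz.pd (v := ez) hU))
      ((hφ.smul (s := 1) hU hby).const_smul hU β) hp
    convert h using 2
    · ext1 p
      rw [smul_sub, smul_comm]
    · simp only [tail, integral_smul]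
  have e3 := tail_pd_smul hU hφz hb hp
  have e4 := tail_pd_smul hU hφ hbz hp
  have e5 := pd_tail_smul (v := ey) hU hφ hb hp
  have e6 := pd_ez_pd_ez_eval_tail hU hx.sm hφ hb hp
  have e7 : pd U ey (fun p => x p (tail (fun p => φ p • b p) p)) p = _ :=
    congrFun (pd_eval hU hx.sm (hs.tail hU).sm) p
  have e8 : vol x b φ = fun p => φ p - x p (tail (fun p => φ p • b p) p) := rfl
  simp only [opL, potU, remL]
  rw [opL₀, e8, pd_sub hU hφ.sm hv, pd_sub hU hφ.sm hv,
    pd_sub hU (hφ.sm.pd hU) (hv.pd hU)]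
  beta_reduce
  rw [e6, e7, e5, e2, vol, e1, e3, e4,
    pd_mul hU hφ.sm (hx.sm.eval hb.sm), pd_eval hU hx.sm hb.sm]
  simp only [opL₀, map_sub, map_neg, map_add, map_smul, smul_eq_mul, add_apply,
    sub_apply, smul_apply]
  ring

/-- The commutation defect of `M₀` and `M_u` with a separable Volterra operator is an integral
operator; the boundary terms cancel by the definition of `u` and `w` and by the equation for the
kernel on the diagonal. -/
theorem opM_vol_sub_vol_opM₀ (hU : IsOpen U) (hx : Adm 2 U x) (hb : Adm 2 U b) (hφ : Adm 2 U φ)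
    (hp : p ∈ Ioi (0 : ℝ) ×ˢ U)
    (hdiag : x p (pd U ez (pd U ez b) p - β • pd U ey b p)
      = remL U β (potU U x b) x p (b p)) :
    opM U α (potU U x b) (potW U β x b) (vol x b φ) p - vol x b (opM₀ U α φ) p =
      - x p (tail (fun p => φ p • (pd U ez (pd U ez (pd U ez b)) p + α • pd U et b p)) p)
        - remM U α (potU U x b) (potW U β x b) x p (tail (fun p => φ p • b p) p) := by
  have hs := hφ.smul (s := 1) hU hb
  have hv := (hx.eval_tail hU hφ hb).sm
  have hφz := hφ.pd (v := ez) hU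
  have hbz := hb.pd (v := ez) hU
  have hφzz := hφz.pd (v := ez) hU
  have hbzz := hbz.pd (v := ez) hU
  have hφt := hφ.pd (v := et) hU
  have hbt := hb.pd (v := et) hU
  have hxz := hx.pd (v := ez) hU
  have e1 : tail (fun p => opM₀ U α φ p • b p) p
      = α • tail (fun p => pd U et φ p • b p) p
        + tail (fun p => pd U ez (pd U ez (pd U ez φ)) p • b p) p := by
    have h := tail_add ((hφt.smul (s := 1) hU hb).const_smul hU α)
      ((hφzz.pd (v := ez) hU).smul (s := 1) hU hb) hp
    convert h using 2
    · ext1 p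
      simp only [opM₀, add_smul, mul_smul]
    · simp only [tail, integral_smul]
  have e2 : tail (fun p => φ p • (pd U ez (pd U ez (pd U ez b)) p + α • pd U et b p)) p
      = tail (fun p => φ p • pd U ez (pd U ez (pd U ez b)) p) p
        + α • tail (fun p => φ p • pd U et b p) p := by
    have h := tail_add (hφ.smul (s := 1) hU (hbzz.pd (v := ez) hU))
      ((hφ.smul (s := 1) hU hbt).const_smul hU α) hp
    convert h using 2
    · ext1 p
      rw [smul_add, smul_comm α]
    · simp only [tail, integral_smul]
  have e3 := tail_pd_smul hU hφzz hb hp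
  have e4 := tail_pd_smul hU hφz hbz hp
  have e5 := tail_pd_smul hU hφ hbzz hp
  have e6 := pd_tail_smul (v := et) hU hφ hb hp
  have e7 := pd_ez_pd_ez_pd_ez_eval_tail hU hx.sm hφ hb hp
  have e8 := pd_ez_eval_tail hU hx.sm hφ hb hp
  have e9 : pd U et (fun p => x p (tail (fun p => φ p • b p) p)) p = _ :=
    congrFun (pd_eval hU hx.sm (hs.tail hU).sm) p
  have e10 : vol x b φ = fun p => φ p - x p (tail (fun p => φ p • b p) p) := rfl
  have hxb := hx.sm.eval hb.sm
  -- the derivatives of `φ(z) x(z) b(z)`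
  have d1 : pd U ez (fun p => x p (b p)) = _ := pd_eval hU hx.sm hb.sm
  have d2 : pd U ez (fun p => pd U ez x p (b p)) = _ := pd_eval hU hxz.sm hb.sm
  have d3 : pd U ez (fun p => x p (pd U ez b p)) = _ := pd_eval hU hx.sm hbz.sm
  have d4 : pd U ez (fun p => φ p * x p (b p)) = _ := pd_mul hU hφ.sm hxb
  have d5 : pd U ez (fun p => pd U ez φ p * x p (b p)) = _ := pd_mul hU hφz.sm hxb
  have d6 : pd U ez (fun p => φ p * pd U ez x p (b p)) = _ :=
    pd_mul hU hφ.sm (hxz.sm.eval hb.sm)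
  have d7 : pd U ez (fun p => pd U ez x p (b p) + x p (pd U ez b p)) = _ :=
    pd_add hU (hxz.sm.eval hb.sm) (hx.sm.eval hbz.sm)
  have d8 : pd U ez (fun p => φ p * (pd U ez x p (b p) + x p (pd U ez b p))) = _ :=
    pd_mul hU hφ.sm ((hxz.sm.eval hb.sm).add (hx.sm.eval hbz.sm))
  have d9 : pd U ez (fun p => pd U ez φ p * x p (b p)
      + φ p * (pd U ez x p (b p) + x p (pd U ez b p))) = _ :=
    pd_add hU (hφz.sm.mul hxb) (hφ.sm.mul ((hxz.sm.eval hb.sm).add (hx.sm.eval hbz.sm)))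
  have d11 : pd U ez (potU U x b) = _ := pd_const_mul hU 2 (hxb.pd (v := ez) hU)
  have d12 : pd U ey (fun p => x p (b p)) = _ := pd_eval hU hx.sm hb.sm
  simp only [remL, potU, d1, add_apply, map_sub, map_smul, smul_eq_mul,
    sub_apply, smul_apply] at hdiag
  simp only [opM, opM₀, remM]
  rw [e10, pd_sub hU hφ.sm hv, pd_sub hU hφ.sm hv,
    pd_sub hU (hφ.sm.pd hU) (hv.pd hU), pd_sub hU ((hφ.sm.pd hU).pd hU) ((hv.pd hU).pd hU), vol]
  beta_reduce
  rw [e9, e8, e7, e6, e2]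
  change _ - (opM₀ U α φ p - x p (tail (fun p => opM₀ U α φ p • b p) p)) = _
  rw [e1, e3, e4, e5]
  simp only [opM₀, potU, potW, d11, d9, d8, d7, d6, d5, d4, d3, d2, d1, d12, map_sub, map_neg,
    map_add, map_smul, smul_eq_mul, add_apply,
    sub_apply, smul_apply]
  linear_combination (-(3 / 2) * φ p) * hdiag

end Intertwining

/-! ### The Gelfand-Levitan equation -/

section Kernel

variable {H : Type*} [NormedAddCommGroup H] [NormedSpace ℂ H]
  {U : Set (ℝ × ℝ)} {p : ℝ × ℝ × ℝ} {φ ψ : ℝ × ℝ × ℝ → ℂ} {b : ℝ × ℝ × ℝ → H}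
  {c : ℝ × ℝ × ℝ → H →L[ℂ] ℂ} {α β : ℂ}

/-- The operator `R = ∫_z^∞ b(ζ) c(ζ) dζ`. -/
noncomputable def opR (b : ℝ × ℝ × ℝ → H) (c : ℝ × ℝ × ℝ → H →L[ℂ] ℂ) :
    ℝ × ℝ × ℝ → H →L[ℂ] H := tail fun p => (c p).smulRight (b p)

/-- The resolvent `(I + R)⁻¹`. -/
noncomputable def opX (b : ℝ × ℝ × ℝ → H) (c : ℝ × ℝ × ℝ → H →L[ℂ] ℂ) (p : ℝ × ℝ × ℝ) :
    H →L[ℂ] H := Ring.inverse (1 + opR b c p)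

/-- The functional `ξ(z) = c(z) (I + R)⁻¹`, so that `K(z, ζ) = -ξ(z) b(ζ)`. -/
noncomputable def xi (b : ℝ × ℝ × ℝ → H) (c : ℝ × ℝ × ℝ → H →L[ℂ] ℂ) (p : ℝ × ℝ × ℝ) :
    H →L[ℂ] ℂ := (c p).comp (opX b c p)

theorem adm_rank (hU : IsOpen U) (hb : Adm 2 U b) (hc : Adm 2 U c) :
    Adm 1 U (fun p => (c p).smulRight (b p)) := hc.bilin hU (rankB H H) hb

theorem opX_apply_add (hR : ∀ p ∈ Ioi (0 : ℝ) ×ˢ U, IsUnit (1 + opR b c p))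
    (hp : p ∈ Ioi (0 : ℝ) ×ˢ U) (h : H) : opX b c p h + opX b c p (opR b c p h) = h := by
  have h1 : opX b c p * (1 + opR b c p) = 1 := Ring.inverse_mul_cancel _ (hR p hp)
  simpa using DFunLike.congr_fun h1 h

theorem opX_apply_add' (hR : ∀ p ∈ Ioi (0 : ℝ) ×ˢ U, IsUnit (1 + opR b c p))
    (hp : p ∈ Ioi (0 : ℝ) ×ˢ U) (h : H) : opX b c p h + opR b c p (opX b c p h) = h := by
  have h1 : (1 + opR b c p) * opX b c p = 1 := Ring.mul_inverse_cancel _ (hR p hp)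
  simpa using DFunLike.congr_fun h1 h

theorem xi_apply_add (hR : ∀ p ∈ Ioi (0 : ℝ) ×ˢ U, IsUnit (1 + opR b c p))
    (hp : p ∈ Ioi (0 : ℝ) ×ˢ U) (h : H) : xi b c p h + xi b c p (opR b c p h) = c p h := by
  rw [xi, ContinuousLinearMap.comp_apply, ContinuousLinearMap.comp_apply, ← map_add,
    opX_apply_add hR hp]

theorem vol_congr {x : ℝ × ℝ × ℝ → H →L[ℂ] ℂ} (hp : p ∈ Ioi (0 : ℝ) ×ˢ U)
    (h : ∀ η, 0 < η → φ (η, p.2) = ψ (η, p.2)) : vol x b φ p = vol x b ψ p := by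
  have h1 : tail (fun p => φ p • b p) p = tail (fun p => ψ p • b p) p :=
    setIntegral_congr_fun measurableSet_Ioi fun η hη => by
      simp only [h η ((mem_Ioi.1 hp.1).trans hη)]
  rw [vol, vol, h1, show φ p = ψ p from h p.1 hp.1]

theorem opR_apply (hU : IsOpen U) (hb : Adm 2 U b) (hc : Adm 2 U c) (hp : p ∈ Ioi (0 : ℝ) ×ˢ U)
    (h : H) : opR b c p h = tail (fun p => c p h • b p) p :=
  ContinuousLinearMap.integral_apply ((adm_rank hU hb hc 0).integrableOn hp) h

/-- `I + K` maps `c(z) h` to `ξ(z) h`. This is the Gelfand-Levitan equation, for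
`h = b(ζ)`. -/
theorem vol_xi_eval (hU : IsOpen U) (hb : Adm 2 U b) (hc : Adm 2 U c)
    (hR : ∀ p ∈ Ioi (0 : ℝ) ×ˢ U, IsUnit (1 + opR b c p)) (h : H) (hp : p ∈ Ioi (0 : ℝ) ×ˢ U) :
    vol (xi b c) b (fun p => c p h) p = xi b c p h := by
  rw [vol, ← opR_apply hU hb hc hp, ← xi_apply_add hR hp h, add_sub_cancel_right]

variable [CompleteSpace H]

theorem adm_opR (hU : IsOpen U) (hb : Adm 2 U b) (hc : Adm 2 U c) : Adm ⊤ U (opR b c) :=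
  (adm_rank hU hb hc).tail hU

theorem adm_opX (hU : IsOpen U) (hb : Adm 2 U b) (hc : Adm 2 U c)
    (hR : ∀ p ∈ Ioi (0 : ℝ) ×ˢ U, IsUnit (1 + opR b c p)) : Adm ⊤ U (opX b c) := fun n =>
  (adm_opR hU hb hc n).inverse_one_add hU hR fun _ ha =>
    (adm_rank hU hb hc 0).locDom.tail_eventually_le ha (by norm_num)

theorem adm_xi (hU : IsOpen U) (hb : Adm 2 U b) (hc : Adm 2 U c)
    (hR : ∀ p ∈ Ioi (0 : ℝ) ×ˢ U, IsUnit (1 + opR b c p)) : Adm 2 U (xi b c) :=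
  hc.comp (r := ⊤) hU (adm_opX hU hb hc hR)

/-- The Gelfand-Levitan equation has no square integrable solutions besides the given one: for a
solution `k` of the homogeneous equation, the functional `∫ k(η) c(η) dη` vanishes on the range of
`I + R`, which is the whole space. -/
theorem eq_zero_of_homogeneous (hU : IsOpen U) (hb : Adm 2 U b) (hc : Adm 2 U c)
    (hR : ∀ p ∈ Ioi (0 : ℝ) ×ˢ U, IsUnit (1 + opR b c p)) (hp : p ∈ Ioi (0 : ℝ) ×ˢ U) {k : ℝ → ℂ}
    (hk : MemLp k 2 (volume.restrict (Ioi p.1)))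
    (h : ∀ ζ, p.1 < ζ → k ζ + ∫ η in Ioi p.1, k η * c (η, p.2) (b (ζ, p.2)) = 0) :
    (∀ d : H, ∫ η in Ioi p.1, k η * c (η, p.2) d = 0) ∧ ∀ ζ, p.1 < ζ → k ζ = 0 := by
  have hc2 : MemLp (fun η => c (η, p.2)) 2 (volume.restrict (Ioi p.1)) := (hc 0).memLp hp
  have hi : Integrable (fun η => k η • c (η, p.2)) (volume.restrict (Ioi p.1)) :=
    memLp_one_iff_integrable.1 (hc2.smul hk)
  set m : H →L[ℂ] ℂ := ∫ η in Ioi p.1, k η • c (η, p.2) with hm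
  have hmd : ∀ d : H, m d = ∫ η in Ioi p.1, k η * c (η, p.2) d := fun d =>
    ContinuousLinearMap.integral_apply hi d
  have hk' : ∀ ζ, p.1 < ζ → k ζ = - m (b (ζ, p.2)) := fun ζ hζ => by
    rw [hmd]; exact eq_neg_of_add_eq_zero_left (h ζ hζ)
  have hmR : ∀ d, m d = - m (opR b c p d) := fun d => by
    have h1 : m (opR b c p d) = ∫ η in Ioi p.1, m (c (η, p.2) d • b (η, p.2)) := by
      rw [opR_apply hU hb hc hp]
      exact (m.integral_comp_comm
        ((((hc.eval_const hU d).smul (s := 1) hU hb) 0).integrableOn hp)).symm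
    rw [h1, hmd, ← integral_neg]
    refine setIntegral_congr_fun measurableSet_Ioi fun η hη => ?_
    simp only [hk' η hη, map_smul, smul_eq_mul]
    ring
  have hm0 : ∀ d, m d = 0 := fun d => by
    have h1 := opX_apply_add' hR hp d
    have h2 := hmR (opX b c p d)
    rw [← h1, map_add, h2, neg_add_cancel]
  exact ⟨fun d => by rw [← hmd, hm0], fun ζ hζ => by rw [hk' ζ hζ, hm0, neg_zero]⟩

/-- The function of `ζ` which is the remainder in the intertwining relations is square integrable,
and its integral against `φ` is the remainder. -/
theorem remainder_eq_integral (hU : IsOpen U) {d e : ℝ × ℝ × ℝ → H} (hd : Adm 2 U d)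
    (he : Adm 2 U e) (hφ : Adm 2 U φ) (ℓ m : H →L[ℂ] ℂ) (hp : p ∈ Ioi (0 : ℝ) ×ˢ U) :
    MemLp (fun η => ℓ (d (η, p.2)) + m (e (η, p.2))) 2 (volume.restrict (Ioi p.1)) ∧
    ∫ η in Ioi p.1, (ℓ (d (η, p.2)) + m (e (η, p.2))) * φ (η, p.2)
      = ℓ (tail (fun p => φ p • d p) p) + m (tail (fun p => φ p • e p) p) := by
  have h1 := clm_tail_smul (ℓ := ℓ) hU hφ hd hp
  have h2 := clm_tail_smul (ℓ := m) hU hφ he hp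
  refine ⟨(ℓ.comp_memLp' ((hd 0).memLp hp)).add (m.comp_memLp' ((he 0).memLp hp)), ?_⟩
  rw [← h1.2, ← h2.2, ← integral_add h1.1 h2.1]
  simp only [add_mul]

/-- The common scheme for both kernel equations: if the remainder `ξ(z) d(ζ) + m b(ζ)`, integrated
against `c(·) h`, gives its negative at `ζ` for `h = b(ζ)`, then it vanishes. -/
theorem remainder_eq_zero (hU : IsOpen U) (hb : Adm 2 U b) (hc : Adm 2 U c)
    (hR : ∀ p ∈ Ioi (0 : ℝ) ×ˢ U, IsUnit (1 + opR b c p)) {d : ℝ × ℝ × ℝ → H} (hd : Adm 2 U d)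
    (ℓ m : H →L[ℂ] ℂ) (hp : p ∈ Ioi (0 : ℝ) ×ˢ U)
    (h : ∀ ζ, 0 < ζ → ℓ (tail (fun q => c q (b (ζ, p.2)) • d q) p)
      + m (tail (fun q => c q (b (ζ, p.2)) • b q) p)
        = - (ℓ (d (ζ, p.2)) + m (b (ζ, p.2)))) :
    ∀ ζ, 0 < ζ → ℓ (d (ζ, p.2)) + m (b (ζ, p.2)) = 0 := by
  have h1 := fun h' => remainder_eq_integral hU hd hb (hc.eval_const hU h') ℓ m hp
  have h2 := (eq_zero_of_homogeneous hU hb hc hR hp (h1 0).1 fun ζ hζ => by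
    rw [(h1 _).2, h ζ ((mem_Ioi.1 hp.1).trans hζ), add_neg_cancel]).1
  intro ζ hζ
  rw [← neg_eq_zero, ← h ζ hζ, ← (h1 _).2, h2]

/-- The equation `β K_y + K_zz - K_ζζ = u K` for the kernel `K = -ξ(z) b(ζ)`. -/
theorem kernel_eq_L (hU : IsOpen U) (hb : Adm 2 U b) (hc : Adm 2 U c)
    (hR : ∀ p ∈ Ioi (0 : ℝ) ×ˢ U, IsUnit (1 + opR b c p))
    (hy : ∀ z ζ a, 0 < z → 0 < ζ → a ∈ U →
      (β • pd U ey c (z, a) + pd U ez (pd U ez c) (z, a)) (b (ζ, a))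
        = c (z, a) (pd U ez (pd U ez b) (ζ, a) - β • pd U ey b (ζ, a)))
    (hp : p ∈ Ioi (0 : ℝ) ×ˢ U) {ζ : ℝ} (hζ : 0 < ζ) :
    xi b c p (pd U ez (pd U ez b) (ζ, p.2) - β • pd U ey b (ζ, p.2))
      = remL U β (potU U (xi b c) b) (xi b c) p (b (ζ, p.2)) := by
  have hx := adm_xi hU hb hc hR
  have hd : Adm 2 U (fun p => pd U ez (pd U ez b) p - β • pd U ey b p) :=
    ((hb.pd hU).pd hU).sub hU ((hb.pd hU).const_smul hU β)
  rw [← sub_eq_zero, sub_eq_add_neg]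
  refine remainder_eq_zero hU hb hc hR hd (xi b c p)
    (-remL U β (potU U (xi b c) b) (xi b c) p) hp ?_ ζ hζ
  intro ζ hζ
  set h := b (ζ, p.2)
  have h1 := vol_opL₀_sub_opL_vol (β := β) hU hx hb (hc.eval_const hU h) hp
  have h2 : EqOn (vol (xi b c) b (fun p => c p h)) (fun p => xi b c p h) (Ioi (0 : ℝ) ×ˢ U) :=
    fun q hq => vol_xi_eval hU hb hc hR h hq
  have h3 : vol (xi b c) b (opL₀ U β fun p => c p h) p
      = - xi b c p (pd U ez (pd U ez b) (ζ, p.2) - β • pd U ey b (ζ, p.2)) := by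
    rw [vol_congr (ψ := fun q => c q (-(pd U ez (pd U ez b) (ζ, p.2) - β • pd U ey b (ζ, p.2)))) hp,
      vol_xi_eval hU hb hc hR _ hp, map_neg]
    intro η hη
    rw [map_neg, ← hy η ζ p.2 hη hζ hp.2, opL₀, pd_eval_const hU hc.sm,
      pd_eval_const hU hc.sm, pd_eval_const hU (hc.sm.pd hU)]
    simp [h]
  rw [neg_apply, ← sub_eq_add_neg, ← h1, h3, opL, opL₀, pd_congr hU h2,
    pd_congr hU h2, h2 hp]
  beta_reduce
  rw [pd_eval_const hU hx.sm, pd_eval_const hU hx.sm, pd_eval_const hU (hx.sm.pd hU)]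
  simp only [remL, neg_apply, add_apply, sub_apply, smul_apply, smul_eq_mul]
  ring

/-- The equation `α K_t + K_zzz + K_ζζζ - (3/2) u K_z - (3/4) u_z K + w K = 0` for the kernel
`K = -ξ(z) b(ζ)`. -/
theorem kernel_eq_M (hU : IsOpen U) (hb : Adm 2 U b) (hc : Adm 2 U c)
    (hR : ∀ p ∈ Ioi (0 : ℝ) ×ˢ U, IsUnit (1 + opR b c p))
    (hy : ∀ z ζ a, 0 < z → 0 < ζ → a ∈ U →
      (β • pd U ey c (z, a) + pd U ez (pd U ez c) (z, a)) (b (ζ, a))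
        = c (z, a) (pd U ez (pd U ez b) (ζ, a) - β • pd U ey b (ζ, a)))
    (ht : ∀ z ζ a, 0 < z → 0 < ζ → a ∈ U →
      (α • pd U et c (z, a) + pd U ez (pd U ez (pd U ez c)) (z, a)) (b (ζ, a))
        = - c (z, a) (pd U ez (pd U ez (pd U ez b)) (ζ, a) + α • pd U et b (ζ, a)))
    (hp : p ∈ Ioi (0 : ℝ) ×ˢ U) {ζ : ℝ} (hζ : 0 < ζ) :
    xi b c p (pd U ez (pd U ez (pd U ez b)) (ζ, p.2) + α • pd U et b (ζ, p.2))
      + remM U α (potU U (xi b c) b) (potW U β (xi b c) b) (xi b c) p (b (ζ, p.2)) = 0 := by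
  have hx := adm_xi hU hb hc hR
  have hd : Adm 2 U (fun p => pd U ez (pd U ez (pd U ez b)) p + α • pd U et b p) :=
    (((hb.pd hU).pd hU).pd hU).add hU ((hb.pd hU).const_smul hU α)
  refine remainder_eq_zero hU hb hc hR hd (xi b c p) _ hp ?_ ζ hζ
  intro ζ hζ
  set h := b (ζ, p.2)
  have h1 := opM_vol_sub_vol_opM₀ (α := α) hU hx hb (hc.eval_const hU h) hp
    (kernel_eq_L hU hb hc hR hy hp hp.1)
  have h2 : EqOn (vol (xi b c) b (fun p => c p h)) (fun p => xi b c p h) (Ioi (0 : ℝ) ×ˢ U) :=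
    fun q hq => vol_xi_eval hU hb hc hR h hq
  have h3 : vol (xi b c) b (opM₀ U α fun p => c p h) p
      = - xi b c p (pd U ez (pd U ez (pd U ez b)) (ζ, p.2) + α • pd U et b (ζ, p.2)) := by
    rw [vol_congr (ψ := fun q =>
        c q (-(pd U ez (pd U ez (pd U ez b)) (ζ, p.2) + α • pd U et b (ζ, p.2)))) hp,
      vol_xi_eval hU hb hc hR _ hp, map_neg]
    intro η hη
    rw [map_neg, ← ht η ζ p.2 hη hζ hp.2, opM₀, pd_eval_const hU hc.sm,
      pd_eval_const hU hc.sm, pd_eval_const hU (hc.sm.pd hU),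
      pd_eval_const hU ((hc.sm.pd hU).pd hU)]
    simp [h]
  rw [← neg_inj, neg_neg, neg_add, ← sub_eq_add_neg, ← h1, h3, opM, opM₀, pd_congr hU h2,
    pd_congr hU h2, h2 hp]
  beta_reduce
  rw [pd_eval_const hU hx.sm, pd_eval_const hU hx.sm, pd_eval_const hU (hx.sm.pd hU),
    pd_eval_const hU ((hx.sm.pd hU).pd hU)]
  simp only [remM, add_apply, sub_apply, smul_apply, smul_eq_mul]
  ring

/-- The relation `L_u (I + K) = (I + K) L₀`. -/
theorem opL_vol (hU : IsOpen U) (hb : Adm 2 U b) (hc : Adm 2 U c)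
    (hR : ∀ p ∈ Ioi (0 : ℝ) ×ˢ U, IsUnit (1 + opR b c p))
    (hy : ∀ z ζ a, 0 < z → 0 < ζ → a ∈ U →
      (β • pd U ey c (z, a) + pd U ez (pd U ez c) (z, a)) (b (ζ, a))
        = c (z, a) (pd U ez (pd U ez b) (ζ, a) - β • pd U ey b (ζ, a)))
    (hφ : Adm 2 U φ) (hp : p ∈ Ioi (0 : ℝ) ×ˢ U) :
    opL U β (potU U (xi b c) b) (vol (xi b c) b φ) p = vol (xi b c) b (opL₀ U β φ) p := by
  have hd : Adm 2 U (fun p => pd U ez (pd U ez b) p - β • pd U ey b p) :=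
    ((hb.pd hU).pd hU).sub hU ((hb.pd hU).const_smul hU β)
  have h1 := vol_opL₀_sub_opL_vol (β := β) hU (adm_xi hU hb hc hR) hb hφ hp
  have h2 := (remainder_eq_integral hU hd hb hφ (xi b c p)
    (-remL U β (potU U (xi b c) b) (xi b c) p) hp).2
  rw [neg_apply, ← sub_eq_add_neg, ← h1] at h2
  rw [eq_comm, ← sub_eq_zero, ← h2]
  refine setIntegral_eq_zero_of_forall_eq_zero fun η hη => ?_
  rw [kernel_eq_L hU hb hc hR hy hp ((mem_Ioi.1 hp.1).trans hη), neg_apply, add_neg_cancel,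
    zero_mul]

/-- The relation `M_u (I + K) = (I + K) M₀`. -/
theorem opM_vol (hU : IsOpen U) (hb : Adm 2 U b) (hc : Adm 2 U c)
    (hR : ∀ p ∈ Ioi (0 : ℝ) ×ˢ U, IsUnit (1 + opR b c p))
    (hy : ∀ z ζ a, 0 < z → 0 < ζ → a ∈ U →
      (β • pd U ey c (z, a) + pd U ez (pd U ez c) (z, a)) (b (ζ, a))
        = c (z, a) (pd U ez (pd U ez b) (ζ, a) - β • pd U ey b (ζ, a)))
    (ht : ∀ z ζ a, 0 < z → 0 < ζ → a ∈ U →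
      (α • pd U et c (z, a) + pd U ez (pd U ez (pd U ez c)) (z, a)) (b (ζ, a))
        = - c (z, a) (pd U ez (pd U ez (pd U ez b)) (ζ, a) + α • pd U et b (ζ, a)))
    (hφ : Adm 2 U φ) (hp : p ∈ Ioi (0 : ℝ) ×ˢ U) :
    opM U α (potU U (xi b c) b) (potW U β (xi b c) b) (vol (xi b c) b φ) p
      = vol (xi b c) b (opM₀ U α φ) p := by
  have hd : Adm 2 U (fun p => pd U ez (pd U ez (pd U ez b)) p + α • pd U et b p) :=
    (((hb.pd hU).pd hU).pd hU).add hU ((hb.pd hU).const_smul hU α)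
  have h1 := opM_vol_sub_vol_opM₀ (α := α) hU (adm_xi hU hb hc hR) hb hφ hp
    (kernel_eq_L hU hb hc hR hy hp hp.1)
  have h2 := (remainder_eq_integral hU hd hb hφ (xi b c p)
    (remM U α (potU U (xi b c) b) (potW U β (xi b c) b) (xi b c) p) hp).2
  rw [setIntegral_eq_zero_of_forall_eq_zero] at h2
  · rw [← sub_eq_zero, h1, ← neg_add', ← h2, neg_zero]
  · intro η hη
    rw [kernel_eq_M hU hb hc hR hy ht hp ((mem_Ioi.1 hp.1).trans hη), zero_mul]

/-! ### The inverse of the Volterra operator -/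

/-- The inverse `I + J` of `I + K`: the Volterra operator with the kernel
`J(z, ζ) = c(z) (I + R_ζ)⁻¹ b(ζ)`, in which the resolvent is evaluated at the second variable. -/
noncomputable def volInv (b : ℝ × ℝ × ℝ → H) (c : ℝ × ℝ × ℝ → H →L[ℂ] ℂ) (φ : ℝ × ℝ × ℝ → ℂ)
    (p : ℝ × ℝ × ℝ) : ℂ := φ p + c p (tail (fun p => φ p • opX b c p (b p)) p)

theorem adm_volInv (hU : IsOpen U) (hb : Adm 2 U b) (hc : Adm 2 U c)
    (hR : ∀ p ∈ Ioi (0 : ℝ) ×ˢ U, IsUnit (1 + opR b c p)) (hφ : Adm 2 U φ) :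
    Adm 2 U (volInv b c φ) :=
  hφ.add hU (hc.eval_tail hU hφ ((adm_opX hU hb hc hR).eval hU hb))

theorem pd_ez_opR (hU : IsOpen U) (hb : Adm 2 U b) (hc : Adm 2 U c) (hp : p ∈ Ioi (0 : ℝ) ×ˢ U)
    (h : H) : pd U ez (opR b c) p h = - (c p h • b p) := by
  rw [opR, eqOn_pd_ez_tail hU (adm_rank hU hb hc) hp]
  rfl

/-- The resolvent satisfies `∂_z X = X b c X`, as `∂_z R = -b c`. -/
theorem pd_ez_opX (hU : IsOpen U) (hb : Adm 2 U b) (hc : Adm 2 U c)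
    (hR : ∀ p ∈ Ioi (0 : ℝ) ×ˢ U, IsUnit (1 + opR b c p)) (hp : p ∈ Ioi (0 : ℝ) ×ˢ U)
    (h : H) : pd U ez (opX b c) p h = xi b c p h • opX b c p (b p) := by
  have h1 := hasFDerivAt_inverse_one_add ((adm_opR hU hb hc).sm.differentiableAt hU hp).hasFDerivAt
    (hR p hp)
  have h2 : pd U ez (opX b c) p = fderiv ℝ (fun p => Ring.inverse (1 + opR b c p)) p ez :=
    pd_apply hp
  have h3 := pd_ez_opR hU hb hc hp (opX b c p h)
  rw [pd_apply hp] at h3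
  rw [h2, h1.fderiv]
  change -(opX b c p (fderiv ℝ (opR b c) p ez (opX b c p h))) = _
  rw [h3, map_neg, neg_neg, map_smul]
  rfl

theorem tendsto_opX (b : ℝ × ℝ × ℝ → H) (c : ℝ × ℝ × ℝ → H →L[ℂ] ℂ) (a : ℝ × ℝ) :
    Filter.Tendsto (fun z => opX b c (z, a)) Filter.atTop (𝓝 1) := by
  have h1 : Filter.Tendsto (fun z => 1 + opR b c (z, a)) Filter.atTop (𝓝 1) := by
    have h := (tendsto_tail (fun p => (c p).smulRight (b p)) a).const_add 1
    rwa [add_zero] at h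
  have h2 := (NormedRing.inverse_continuousAt (1 : (H →L[ℂ] H)ˣ)).tendsto
  rw [Units.val_one, Ring.inverse_one] at h2
  exact h2.comp h1

/-- With `X = (I + R)⁻¹` and `s(z) = ∫_z^∞ φ X b`, the functions `∫_z^∞ ((I + J) φ) b` and
`(I + R) s` have the same derivative in `z` and both vanish at infinity. -/
theorem vol_volInv (hU : IsOpen U) (hb : Adm 2 U b) (hc : Adm 2 U c)
    (hR : ∀ p ∈ Ioi (0 : ℝ) ×ˢ U, IsUnit (1 + opR b c p)) (hφ : Adm 2 U φ)
    (hp : p ∈ Ioi (0 : ℝ) ×ˢ U) : vol (xi b c) b (volInv b c φ) p = φ p := by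
  have hXb : Adm 2 U (fun p => opX b c p (b p)) := (adm_opX hU hb hc hR).eval hU hb
  have hs := hφ.smul (s := 1) hU hXb
  set s := tail (fun p => φ p • opX b c p (b p)) with hsdef
  have hsm : Sm U s := (hs.tail hU).sm
  have hRs : Sm U (fun p => opR b c p (s p)) := (adm_opR hU hb hc).sm.eval hsm
  have key : tail (fun p => volInv b c φ p • b p) p = s p + opR b c p (s p) := by
    refine tail_eq_of_pd hU (f := fun p => s p + opR b c p (s p)) (hsm.add hRs)
      ((adm_volInv hU hb hc hR hφ).smul (s := 1) hU hb 0) (fun q hq => ?_) hp ?_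
    · have h1 : pd U ez s q = - (φ q • opX b c q (b q)) := eqOn_pd_ez_tail hU hs hq
      rw [pd_add hU hsm hRs, pd_eval hU (adm_opR hU hb hc).sm hsm]
      beta_reduce
      rw [pd_ez_opR hU hb hc hq, h1, map_neg, map_smul, volInv, ← hsdef, add_smul]
      rw [show φ q • b q = φ q • opX b c q (b q) + φ q • opR b c q (opX b c q (b q)) by
        rw [← smul_add, opX_apply_add' hR hq]]
      abel
    · have h1 : Filter.Tendsto (fun z => s (z, p.2)) Filter.atTop (𝓝 0) := tendsto_tail _ _
      have h2 : Filter.Tendsto (fun z => opR b c (z, p.2)) Filter.atTop (𝓝 0) := tendsto_tail _ _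
      simpa using h1.add
        ((isBoundedBilinearMap_apply.continuous.tendsto _).comp (h2.prodMk_nhds h1))
  rw [vol, key, map_add, xi_apply_add hR hp, volInv, add_sub_cancel_right]

/-- With `X = (I + R)⁻¹` and `s(z) = ∫_z^∞ φ b`, the functions `∫_z^∞ ((I + K) φ) X b` and `X s`
have the same derivative in `z` and both vanish at infinity. -/
theorem volInv_vol (hU : IsOpen U) (hb : Adm 2 U b) (hc : Adm 2 U c)
    (hR : ∀ p ∈ Ioi (0 : ℝ) ×ˢ U, IsUnit (1 + opR b c p)) (hφ : Adm 2 U φ)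
    (hp : p ∈ Ioi (0 : ℝ) ×ˢ U) : volInv b c (vol (xi b c) b φ) p = φ p := by
  have hX := adm_opX hU hb hc hR
  have hs := hφ.smul (s := 1) hU hb
  set s := tail (fun p => φ p • b p) with hsdef
  have hsm : Sm U s := (hs.tail hU).sm
  have key : tail (fun p => vol (xi b c) b φ p • opX b c p (b p)) p = opX b c p (s p) := by
    refine tail_eq_of_pd hU (f := fun p => opX b c p (s p)) (hX.sm.eval hsm)
      (((adm_xi hU hb hc hR).vol hU hb hφ).smul (s := 1) hU (hX.eval (s := 2) hU hb) 0)
      (fun q hq => ?_) hp ?_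
    · have h1 : pd U ez s q = - (φ q • b q) := eqOn_pd_ez_tail hU hs hq
      rw [pd_eval hU hX.sm hsm]
      beta_reduce
      rw [pd_ez_opX hU hb hc hR hq, h1, map_neg, map_smul, vol, ← hsdef, sub_smul]
      abel
    · have h1 : Filter.Tendsto (fun z => s (z, p.2)) Filter.atTop (𝓝 0) := tendsto_tail _ _
      have h2 := (isBoundedBilinearMap_apply.continuous.tendsto _).comp
        ((tendsto_opX b c p.2).prodMk_nhds h1)
      simpa [Function.comp_def] using h2
  rw [volInv, key, vol, ← hsdef, xi, ContinuousLinearMap.comp_apply, sub_add_cancel]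

end Kernel

/-! ### Commutators and the KP equation -/

section Commutators

variable {U : Set (ℝ × ℝ)} {u w φ : ℝ × ℝ × ℝ → ℂ} {α β : ℂ}

/-- The commutator of `L_u` and `M_u` is multiplication by this function, provided that
`w_z = (3β/4) u_y`. -/
noncomputable def curvature (U : Set (ℝ × ℝ)) (α β : ℂ) (u w : ℝ × ℝ × ℝ → ℂ)
    (p : ℝ × ℝ × ℝ) : ℂ :=
  3 / 2 * u p * pd U ez u p - β * pd U ey w p - 1 / 4 * pd U ez (pd U ez (pd U ez u)) p
    - α * pd U et u p

theorem Sm.opL₀ (hU : IsOpen U) (hφ : Sm U φ) : Sm U (KP.opL₀ U β φ) :=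
  ((hφ.pd hU).const_mul β |>.add ((hφ.pd hU).pd hU)).neg

theorem Sm.opM₀ (hU : IsOpen U) (hφ : Sm U φ) : Sm U (KP.opM₀ U α φ) :=
  (hφ.pd hU).const_mul α |>.add (((hφ.pd hU).pd hU).pd hU)

theorem Sm.opL (hU : IsOpen U) (hu : Sm U u) (hφ : Sm U φ) : Sm U (KP.opL U β u φ) :=
  (hφ.opL₀ hU).add (hu.mul hφ)

theorem Sm.opM (hU : IsOpen U) (hu : Sm U u) (hw : Sm U w) (hφ : Sm U φ) :
    Sm U (KP.opM U α u w φ) :=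
  (((hφ.opM₀ hU).sub ((hu.const_mul _).mul (hφ.pd hU))).sub
    (((hu.pd hU).const_mul _).mul hφ)).add (hw.mul hφ)

/-- Operators with constant coefficients commute on smooth functions. -/
theorem opL₀_opM₀_comm (hU : IsOpen U) (hφ : Sm U φ) :
    opL₀ U β (opM₀ U α φ) = opM₀ U α (opL₀ U β φ) := by
  have h1 := fun (f : ℝ × ℝ × ℝ → ℂ) (hf : Sm U f) => pd_comm hU hf et ez
  have h2 := fun (f : ℝ × ℝ × ℝ → ℂ) (hf : Sm U f) => pd_comm hU hf ey ez
  have h3 := fun (f : ℝ × ℝ × ℝ → ℂ) (hf : Sm U f) => pd_comm hU hf ey et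
  have hm : opM₀ U α φ = fun p => α * pd U et φ p + pd U ez (pd U ez (pd U ez φ)) p := rfl
  have hl : opL₀ U β φ = fun p => -(β * pd U ey φ p + pd U ez (pd U ez φ) p) := rfl
  ext1 p
  rw [opL₀, opM₀, hm, hl]
  -- the smoothness side conditions nest deeper than the default discharge depth
  simp (maxDischargeDepth := 12) only [pd_add hU, pd_neg hU, pd_const_mul hU, hφ, Sm.pd hU,
    Sm.add, Sm.const_mul, h1, h2, h3]
  ring

/-- The terms of positive order in the commutator cancel by the choice of the coefficients of `M_u`
and by `w_z = (3β/4) u_y`. -/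
theorem opL_opM_comm (hU : IsOpen U) (hu : Sm U u) (hw : Sm U w) (hφ : Sm U φ)
    (h : pd U ez w = fun p => 3 / 4 * β * pd U ey u p) (p : ℝ × ℝ × ℝ) :
    opL U β u (opM U α u w φ) p - opM U α u w (opL U β u φ) p
      = curvature U α β u w p * φ p := by
  have h1 := fun (f : ℝ × ℝ × ℝ → ℂ) (hf : Sm U f) => pd_comm hU hf et ez
  have h2 := fun (f : ℝ × ℝ × ℝ → ℂ) (hf : Sm U f) => pd_comm hU hf ey ez
  have h3 := fun (f : ℝ × ℝ × ℝ → ℂ) (hf : Sm U f) => pd_comm hU hf ey et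
  have hm : opM U α u w φ = fun p => α * pd U et φ p + pd U ez (pd U ez (pd U ez φ)) p
    - 3 / 2 * u p * pd U ez φ p - 3 / 4 * pd U ez u p * φ p + w p * φ p := rfl
  have hl : opL U β u φ = fun p => -(β * pd U ey φ p + pd U ez (pd U ez φ) p) + u p * φ p := rfl
  rw [opL, opL₀, hm, hl, opM, opM₀, curvature]
  simp (maxDischargeDepth := 12) only [pd_add hU, pd_sub hU, pd_neg hU, pd_const_mul hU,
    pd_mul hU, hφ, hu, hw, h, Sm.pd hU, Sm.add, Sm.sub, Sm.neg, Sm.const_mul, Sm.mul, h1, h2, h3]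
  ring

/-- The KP equation is the derivative in `z` of the vanishing of the curvature. -/
theorem kp_of_curvature (hU : IsOpen U) (hu : Sm U u) (hw : Sm U w)
    (h : pd U ez w = fun p => 3 / 4 * β * pd U ey u p)
    (h0 : EqOn (curvature U α β u w) (fun _ => 0) (Ioi (0 : ℝ) ×ˢ U)) (p : ℝ × ℝ × ℝ) :
    3 * β ^ 2 / 4 * pd U ey (pd U ey u) p
      + pd U ez (fun p => α * pd U et u p + 1 / 4 * pd U ez (pd U ez (pd U ez u)) p
          - 3 / 2 * u p * pd U ez u p) p = 0 := by
  have h1 := congrFun (pd_congr (v := ez) hU h0) p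
  have h2 : pd U ez (fun _ => (0 : ℂ)) p = 0 := by simp [pd, indicator]
  have hc : curvature U α β u w = fun p => 3 / 2 * u p * pd U ez u p - β * pd U ey w p
    - 1 / 4 * pd U ez (pd U ez (pd U ez u)) p - α * pd U et u p := rfl
  have h3 := fun (f : ℝ × ℝ × ℝ → ℂ) (hf : Sm U f) => pd_comm hU hf ez ey
  rw [h2, hc] at h1
  simp (maxDischargeDepth := 12) only [pd_add hU, pd_sub hU, pd_const_mul hU, pd_mul hU, hu, hw,
    h, h3, Sm.pd hU, Sm.add, Sm.sub, Sm.const_mul, Sm.mul] at h1 ⊢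
  linear_combination -h1

end Commutators

section Soliton

variable {H : Type*} [NormedAddCommGroup H] [NormedSpace ℂ H]
  {U : Set (ℝ × ℝ)} {b : ℝ × ℝ × ℝ → H} {c x : ℝ × ℝ × ℝ → H →L[ℂ] ℂ} {α β : ℂ}

theorem Sm.potU (hU : IsOpen U) (hx : Sm U x) (hb : Sm U b) : Sm U (KP.potU U x b) :=
  ((hx.eval hb).pd hU).const_mul 2

theorem Sm.potW (hU : IsOpen U) (hx : Sm U x) (hb : Sm U b) : Sm U (KP.potW U β x b) :=
  ((hx.eval hb).pd hU).const_mul _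

/-- The relation `w_z = (3β/4) u_y`: both sides are mixed derivatives of `K(z, z)`. -/
theorem pd_potW (hU : IsOpen U) (hx : Sm U x) (hb : Sm U b) :
    pd U ez (potW U β x b) = fun p => 3 / 4 * β * pd U ey (potU U x b) p := by
  have h1 : pd U ez (potW U β x b) = _ := pd_const_mul hU (3 * β / 2) ((hx.eval hb).pd (v := ey) hU)
  have h2 : pd U ey (potU U x b) = _ := pd_const_mul hU 2 ((hx.eval hb).pd (v := ez) hU)
  rw [h1, h2, pd_comm hU (hx.eval hb) ez ey]
  ext1 p
  ring

variable [CompleteSpace H]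

/-- The commutator of `L_u` and `M_u` vanishes since it is conjugate to the one of `L₀` and `M₀`;
that it is a multiplication operator is used to see this from one nonvanishing admissible
function. -/
theorem curvature_eq_zero (hU : IsOpen U) (hb : Adm 2 U b) (hc : Adm 2 U c)
    (hR : ∀ p ∈ Ioi (0 : ℝ) ×ˢ U, IsUnit (1 + opR b c p))
    (hy : ∀ z ζ a, 0 < z → 0 < ζ → a ∈ U →
      (β • pd U ey c (z, a) + pd U ez (pd U ez c) (z, a)) (b (ζ, a))
        = c (z, a) (pd U ez (pd U ez b) (ζ, a) - β • pd U ey b (ζ, a)))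
    (ht : ∀ z ζ a, 0 < z → 0 < ζ → a ∈ U →
      (α • pd U et c (z, a) + pd U ez (pd U ez (pd U ez c)) (z, a)) (b (ζ, a))
        = - c (z, a) (pd U ez (pd U ez (pd U ez b)) (ζ, a) + α • pd U et b (ζ, a))) :
    EqOn (curvature U α β (potU U (xi b c) b) (potW U β (xi b c) b)) (fun _ => 0)
      (Ioi (0 : ℝ) ×ˢ U) := by
  intro p hp
  have hx := adm_xi hU hb hc hR
  set u := potU U (xi b c) b with hu_def
  set w := potW U β (xi b c) b with hw_def
  have hu : Sm U u := hx.sm.potU hU hb.sm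
  have hw : Sm U w := hx.sm.potW hU hb.sm
  have hL := fun φ (hφ : Adm 2 U φ) q hq => opL_vol (φ := φ) (p := q) hU hb hc hR hy hφ hq
  have hM := fun φ (hφ : Adm 2 U φ) q hq => opM_vol (φ := φ) (p := q) hU hb hc hR hy ht hφ hq
  have opL_congr : ∀ f g : ℝ × ℝ × ℝ → ℂ, EqOn f g (Ioi (0 : ℝ) ×ˢ U) →
      opL U β u f p = opL U β u g p := fun f g h => by
    simp only [opL, opL₀, pd_congr hU h, h hp]
  have opM_congr : ∀ f g : ℝ × ℝ × ℝ → ℂ, EqOn f g (Ioi (0 : ℝ) ×ˢ U) →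
      opM U α u w f p = opM U α u w g p := fun f g h => by
    simp only [opM, opM₀, pd_congr hU h, h hp]
  -- `(I + K) φ = e^{-z}`, at which the commutator of `L_u` and `M_u` is evaluated
  set φ := volInv b c (fun q => Complex.exp (-(q.1 : ℂ))) with hφ_def
  have hφ : Adm 2 U φ := adm_volInv hU hb hc hR (adm_exp hU)
  have h1 := opL_opM_comm hU hu hw (hx.vol hU hb hφ).sm (pd_potW hU hx.sm hb.sm) (α := α) p
  rw [opL_congr _ _ (fun q hq => hM φ hφ q hq), opM_congr _ _ (fun q hq => hL φ hφ q hq),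
    hL _ (hφ.opM₀ hU) p hp, hM _ (hφ.opL₀ hU) p hp, opL₀_opM₀_comm hU hφ.sm, sub_self,
    vol_volInv hU hb hc hR (adm_exp hU) hp] at h1
  exact (mul_eq_zero.1 h1.symm).resolve_right (Complex.exp_ne_zero _)

end Soliton

/-! ### The differential operators on curried functions -/

section Curried

variable {U : Set (ℝ × ℝ)} {θ u w : ℝ → ℝ → ℝ → ℂ} {F u' w' : ℝ × ℝ × ℝ → ℂ} {α β : ℂ} {z y t : ℝ}

/-- A function of three variables as a function on `ℝ × ℝ × ℝ`. -/
abbrev unc {E : Type*} (θ : ℝ → ℝ → ℝ → E) (p : ℝ × ℝ × ℝ) : E := θ p.1 p.2.1 p.2.2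

theorem sm_of_eqOn (hF : Sm U F) (h : EqOn (unc θ) F (Ioi (0 : ℝ) ×ˢ U)) : Sm U (unc θ) :=
  hF.congr h.symm

theorem eqOnDomain_of_eqOn (h : EqOn (unc θ) (unc u) (Ioi (0 : ℝ) ×ˢ U)) : EqOnDomain U θ u :=
  fun z y t hz ha => @h (z, y, t) ⟨hz, ha⟩

theorem deriv_z_of_eqOn (hU : IsOpen U) (hF : Sm U F) (h : EqOn (unc θ) F (Ioi (0 : ℝ) ×ˢ U))
    (hp : (z, y, t) ∈ Ioi (0 : ℝ) ×ˢ U) :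
    deriv (fun s => θ s y t) z = pd U ez F (z, y, t) := by
  rw [← pd_congr hU h]
  exact (hasDerivAt_z hU (sm_of_eqOn hF h) hp).deriv

theorem deriv_y_of_eqOn (hU : IsOpen U) (hF : Sm U F) (h : EqOn (unc θ) F (Ioi (0 : ℝ) ×ˢ U))
    (hp : (z, y, t) ∈ Ioi (0 : ℝ) ×ˢ U) :
    deriv (fun s => θ z s t) y = pd U ey F (z, y, t) := by
  rw [← pd_congr hU h]
  exact (hasDerivAt_y hU (sm_of_eqOn hF h) hp).deriv

theorem deriv_t_of_eqOn (hU : IsOpen U) (hF : Sm U F) (h : EqOn (unc θ) F (Ioi (0 : ℝ) ×ˢ U))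
    (hp : (z, y, t) ∈ Ioi (0 : ℝ) ×ˢ U) :
    deriv (fun s => θ z y s) t = pd U et F (z, y, t) := by
  rw [← pd_congr hU h]
  exact (hasDerivAt_t hU (sm_of_eqOn hF h) hp).deriv

theorem iteratedDeriv_two_z_of_eqOn (hU : IsOpen U) (hF : Sm U F)
    (h : EqOn (unc θ) F (Ioi (0 : ℝ) ×ˢ U)) (hp : (z, y, t) ∈ Ioi (0 : ℝ) ×ˢ U) :
    iteratedDeriv 2 (fun s => θ s y t) z = pd U ez (pd U ez F) (z, y, t) := by
  rw [← pd_congr hU h]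
  exact iteratedDeriv_z hU (sm_of_eqOn hF h) 2 hp

theorem iteratedDeriv_three_z_of_eqOn (hU : IsOpen U) (hF : Sm U F)
    (h : EqOn (unc θ) F (Ioi (0 : ℝ) ×ˢ U)) (hp : (z, y, t) ∈ Ioi (0 : ℝ) ×ˢ U) :
    iteratedDeriv 3 (fun s => θ s y t) z = pd U ez (pd U ez (pd U ez F)) (z, y, t) := by
  rw [← pd_congr hU h]
  exact iteratedDeriv_z hU (sm_of_eqOn hF h) 3 hp

theorem iteratedDeriv_two_y_of_eqOn (hU : IsOpen U) (hF : Sm U F)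
    (h : EqOn (unc θ) F (Ioi (0 : ℝ) ×ˢ U)) (hp : (z, y, t) ∈ Ioi (0 : ℝ) ×ˢ U) :
    iteratedDeriv 2 (fun s => θ z s t) y = pd U ey (pd U ey F) (z, y, t) := by
  rw [← pd_congr hU h]
  exact iteratedDeriv_y hU (sm_of_eqOn hF h) 2 hp

theorem eqOn_L₀ (hU : IsOpen U) (hF : Sm U F) (h : EqOn (unc θ) F (Ioi (0 : ℝ) ×ˢ U)) :
    EqOn (unc (L₀ β θ)) (opL₀ U β F) (Ioi (0 : ℝ) ×ˢ U) := fun p hp => by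
  rw [unc, L₀, deriv_y_of_eqOn hU hF h hp, iteratedDeriv_two_z_of_eqOn hU hF h hp, opL₀]

theorem eqOn_M₀ (hU : IsOpen U) (hF : Sm U F) (h : EqOn (unc θ) F (Ioi (0 : ℝ) ×ˢ U)) :
    EqOn (unc (M₀ α θ)) (opM₀ U α F) (Ioi (0 : ℝ) ×ˢ U) := fun p hp => by
  rw [unc, M₀, deriv_t_of_eqOn hU hF h hp, iteratedDeriv_three_z_of_eqOn hU hF h hp, opM₀]

theorem eqOn_L (hU : IsOpen U) (hF : Sm U F) (h : EqOn (unc θ) F (Ioi (0 : ℝ) ×ˢ U))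
    (hu : EqOn (unc u) u' (Ioi (0 : ℝ) ×ˢ U)) :
    EqOn (unc (L β u θ)) (opL U β u' F) (Ioi (0 : ℝ) ×ˢ U) := fun p hp => by
  rw [opL, ← eqOn_L₀ hU hF h hp, ← hu hp, ← h hp, unc, L]

theorem eqOn_M (hU : IsOpen U) (hF : Sm U F) (h : EqOn (unc θ) F (Ioi (0 : ℝ) ×ˢ U))
    (hu' : Sm U u') (hu : EqOn (unc u) u' (Ioi (0 : ℝ) ×ˢ U))
    (hw : EqOn (unc w) w' (Ioi (0 : ℝ) ×ˢ U)) :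
    EqOn (unc (M α u w θ)) (opM U α u' w' F) (Ioi (0 : ℝ) ×ˢ U) := fun p hp => by
  rw [opM, ← eqOn_M₀ hU hF h hp, ← hu hp, ← hw hp, ← h hp, unc, M, deriv_z_of_eqOn hU hF h hp,
    deriv_z_of_eqOn hU hu' hu hp]

theorem eqOn_kpExpr (hU : IsOpen U) (hu' : Sm U u') (hu : EqOn (unc u) u' (Ioi (0 : ℝ) ×ˢ U)) :
    EqOn (unc (kpExpr α β u)) (fun p => 3 * β ^ 2 / 4 * pd U ey (pd U ey u') p
      + pd U ez (fun p => α * pd U et u' p + 1 / 4 * pd U ez (pd U ez (pd U ez u')) p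
          - 3 / 2 * u' p * pd U ez u' p) p) (Ioi (0 : ℝ) ×ˢ U) := fun p hp => by
  have hF : Sm U (fun p => α * pd U et u' p + 1 / 4 * pd U ez (pd U ez (pd U ez u')) p
      - 3 / 2 * u' p * pd U ez u' p) :=
    (((hu'.pd hU).const_mul _).add ((((hu'.pd hU).pd hU).pd hU).const_mul _)).sub
      ((hu'.const_mul _).mul (hu'.pd hU))
  rw [unc, kpExpr, iteratedDeriv_two_y_of_eqOn hU hu' hu hp]
  refine congrArg₂ _ rfl (deriv_z_of_eqOn (θ := fun z y t => α * deriv (fun t' => u z y t') t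
      + 1 / 4 * iteratedDeriv 3 (fun s' => u s' y t) z
      - 3 / 2 * u z y t * deriv (fun s' => u s' y t) z) hU hF (fun q hq => ?_) hp)
  rw [unc, deriv_t_of_eqOn hU hu' hu hq, iteratedDeriv_three_z_of_eqOn hU hu' hu hq,
    deriv_z_of_eqOn hU hu' hu hq, ← hu hq]

end Curried

/-! ### The linear system -/

namespace LinearSystemFamily

variable {H : Type*} [NormedAddCommGroup H] [InnerProductSpace ℂ H]
  (S : LinearSystemFamily H) {U : Set (ℝ × ℝ)} {α β : ℂ} {z ζ y t : ℝ}

/-- The output functional as a function on `ℝ × ℝ × ℝ`. -/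
noncomputable def outVec (p : ℝ × ℝ × ℝ) : H →L[ℂ] ℂ := S.out p.1 p.2.1 p.2.2

/-- The input operator, identified with a vector of `H`, as a function on `ℝ × ℝ × ℝ`. -/
noncomputable def inVec (p : ℝ × ℝ × ℝ) : H := S.B p.1 p.2.1 p.2.2 1

/-- The function `ξ = C e^{-zA} (I + R)⁻¹` of the linear system. -/
noncomputable def xi : ℝ × ℝ × ℝ → H →L[ℂ] ℂ := KP.xi S.inVec S.outVec

variable {S}

theorem adm_outVec (hC : SmoothL2 U S.out) : Adm 2 U S.outVec := smoothL2_iff.1 hC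

theorem adm_inVec (hU : IsOpen U) (hB : SmoothL2 U S.B) : Adm 2 U S.inVec :=
  Adm.eval_const (x := unc S.B) hU (smoothL2_iff.1 hB) 1

theorem R_eq_opR (z y t : ℝ) : S.R z y t = opR S.inVec S.outVec (z, y, t) := by
  refine integral_congr_ae (ae_of_all _ fun ζ => ?_)
  ext h
  change S.B ζ y t (S.out ζ y t h) = S.out ζ y t h • S.B ζ y t 1
  rw [← map_smul, smul_eq_mul, mul_one]

theorem K_eq (z ζ y t : ℝ) : S.K z ζ y t = - S.xi (z, y, t) (S.inVec (ζ, y, t)) := by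
  rw [K, R_eq_opR]
  rfl

theorem Φ_eq (z ζ y t : ℝ) : S.Φ z ζ y t = S.outVec (z, y, t) (S.inVec (ζ, y, t)) := rfl

theorem isUnit_one_add_opR (hR : ∀ z y t : ℝ, 0 < z → (y, t) ∈ U → IsUnit (1 + S.R z y t)) :
    ∀ p ∈ Ioi (0 : ℝ) ×ˢ U, IsUnit (1 + opR S.inVec S.outVec p) := fun p hp => by
  have := hR p.1 p.2.1 p.2.2 hp.1 hp.2
  rwa [R_eq_opR] at this

theorem contDiffOn_K (hx : Sm U S.xi) (hb : Sm U S.inVec) :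
    ContDiffOn ℝ ∞ (fun p : ℝ × ℝ × ℝ × ℝ => S.K p.1 p.2.1 p.2.2.1 p.2.2.2)
      (Ioi (0 : ℝ) ×ˢ Ioi (0 : ℝ) ×ˢ U) := by
  simp only [K_eq]
  have h1 : ContDiffOn ℝ ∞ (fun p : ℝ × ℝ × ℝ × ℝ => S.xi (p.1, p.2.2))
      (Ioi (0 : ℝ) ×ˢ Ioi (0 : ℝ) ×ˢ U) :=
    ContDiffOn.comp hx (by fun_prop) fun p hp => ⟨hp.1, hp.2.2⟩
  have h2 : ContDiffOn ℝ ∞ (fun p : ℝ × ℝ × ℝ × ℝ => S.inVec (p.2.1, p.2.2))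
      (Ioi (0 : ℝ) ×ˢ Ioi (0 : ℝ) ×ˢ U) :=
    ContDiffOn.comp hb (by fun_prop) fun p hp => ⟨hp.2.1, hp.2.2⟩
  exact ((evalB H ℂ).isBoundedBilinearMap.contDiff.comp_contDiffOn (h1.prodMk h2)).neg

theorem eqOn_u (hU : IsOpen U) (hx : Sm U S.xi) (hb : Sm U S.inVec) :
    EqOn (unc S.u) (potU U S.xi S.inVec) (Ioi (0 : ℝ) ×ˢ U) := fun p hp => by
  rw [unc, u, potU, deriv_z_of_eqOn (θ := fun z y t => S.K z z y t) hU (hx.eval hb).neg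
    (fun q _ => K_eq _ _ _ _) hp, pd_neg hU (hx.eval hb)]
  ring

theorem eqOn_w (hU : IsOpen U) (hx : Sm U S.xi) (hb : Sm U S.inVec) :
    EqOn (unc (S.w β)) (potW U β S.xi S.inVec) (Ioi (0 : ℝ) ×ˢ U) := fun p hp => by
  rw [unc, w, potW, deriv_y_of_eqOn (θ := fun z y t => S.K z z y t) hU (hx.eval hb).neg
    (fun q _ => K_eq _ _ _ _) hp, pd_neg hU (hx.eval hb)]
  ring

theorem deriv_Φ_y (hU : IsOpen U) (hc : Sm U S.outVec) (hb : Sm U S.inVec) (hz : 0 < z)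
    (hζ : 0 < ζ) (ha : (y, t) ∈ U) :
    deriv (fun y' => S.Φ z ζ y' t) y = pd U ey S.outVec (z, y, t) (S.inVec (ζ, y, t))
      + S.outVec (z, y, t) (pd U ey S.inVec (ζ, y, t)) := by
  rw [add_comm]
  exact ((evalB H ℂ).hasDerivAt_of_bilinear (fun _ => hasDerivAt_y hU hc ⟨hz, ha⟩)
    (fun _ => hasDerivAt_y hU hb ⟨hζ, ha⟩)).deriv

theorem deriv_Φ_t (hU : IsOpen U) (hc : Sm U S.outVec) (hb : Sm U S.inVec) (hz : 0 < z)
    (hζ : 0 < ζ) (ha : (y, t) ∈ U) :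
    deriv (fun t' => S.Φ z ζ y t') t = pd U et S.outVec (z, y, t) (S.inVec (ζ, y, t))
      + S.outVec (z, y, t) (pd U et S.inVec (ζ, y, t)) := by
  rw [add_comm]
  exact ((evalB H ℂ).hasDerivAt_of_bilinear (fun _ => hasDerivAt_t hU hc ⟨hz, ha⟩)
    (fun _ => hasDerivAt_t hU hb ⟨hζ, ha⟩)).deriv

theorem iterate_pd_clm {E F : Type*} [NormedAddCommGroup E] [NormedSpace ℝ E] [NormedAddCommGroup F]
    [NormedSpace ℝ F] (hU : IsOpen U) (ℓ : E →L[ℝ] F) {f : ℝ × ℝ × ℝ → E} (hf : Sm U f)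
    (v : ℝ × ℝ × ℝ) (n : ℕ) :
    (pd U v)^[n] (fun p => ℓ (f p)) = fun p => ℓ ((pd U v)^[n] f p) := by
  induction n with
  | zero => rfl
  | succ n ih =>
    rw [Function.iterate_succ_apply', ih, Function.iterate_succ_apply']
    exact pd_clm hU ℓ (hf.iterate_pd hU n)

theorem iteratedDeriv_Φ_z (hU : IsOpen U) (hc : Sm U S.outVec) (n : ℕ) (hz : 0 < z)
    (ha : (y, t) ∈ U) :
    iteratedDeriv n (fun s => S.Φ s ζ y t) z
      = (pd U ez)^[n] S.outVec (z, y, t) (S.inVec (ζ, y, t)) := by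
  have h := iteratedDeriv_z hU (hc.eval_const (S.inVec (ζ, y, t))) n (z := z) ⟨hz, ha⟩
  have h1 := iterate_pd_clm hU ((evalB H ℂ).flip (S.inVec (ζ, y, t))) hc ez n
  exact h.trans (congrFun h1 _)

theorem iteratedDeriv_Φ_ζ (hU : IsOpen U) (hb : Sm U S.inVec) (n : ℕ) (hζ : 0 < ζ)
    (ha : (y, t) ∈ U) :
    iteratedDeriv n (fun s => S.Φ z s y t) ζ
      = S.outVec (z, y, t) ((pd U ez)^[n] S.inVec (ζ, y, t)) := by
  have h := iteratedDeriv_z hU (hb.clm (evalB H ℂ (S.outVec (z, y, t)))) n (z := ζ) ⟨hζ, ha⟩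
  have h1 := iterate_pd_clm hU (evalB H ℂ (S.outVec (z, y, t))) hb ez n
  exact h.trans (congrFun h1 _)

/-- The operator `I + K` of the linear system is the separable Volterra operator of `ξ` and `B`. -/
theorem eqOn_volterra [CompleteSpace H] (hU : IsOpen U) (hb : Adm 2 U S.inVec)
    {θ : ℝ → ℝ → ℝ → ℂ} {F : ℝ × ℝ × ℝ → ℂ} (hF : Adm 2 U F)
    (h : EqOn (unc θ) F (Ioi (0 : ℝ) ×ˢ U)) :
    EqOn (unc (volterra S.K θ)) (vol S.xi S.inVec F) (Ioi (0 : ℝ) ×ˢ U) ∧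
    ∀ p ∈ Ioi (0 : ℝ) ×ˢ U,
      IntegrableOn (fun η => S.K p.1 η p.2.1 p.2.2 * θ η p.2.1 p.2.2) (Ioi p.1) := by
  have hi := fun p (hp : p ∈ Ioi (0 : ℝ) ×ˢ U) => clm_tail_smul (ℓ := - S.xi p) hU hF hb hp
  have he : ∀ p ∈ Ioi (0 : ℝ) ×ˢ U, EqOn (fun η => S.K p.1 η p.2.1 p.2.2 * θ η p.2.1 p.2.2)
      (fun η => (- S.xi p) (S.inVec (η, p.2)) * F (η, p.2)) (Ioi p.1) := fun p hp η hη => by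
    have h1 : θ η p.2.1 p.2.2 = F (η, p.2) := @h (η, p.2) ⟨(mem_Ioi.1 hp.1).trans hη, hp.2⟩
    beta_reduce
    rw [h1, K_eq]
    rfl
  refine ⟨fun p hp => ?_, fun p hp => (hi p hp).1.congr_fun (he p hp).symm measurableSet_Ioi⟩
  rw [unc, volterra, setIntegral_congr_fun measurableSet_Ioi (he p hp), (hi p hp).2, vol,
    ← h hp, sub_eq_add_neg]
  rfl

theorem gelfandLevitan [CompleteSpace H] (hU : IsOpen U) (hb : Adm 2 U S.inVec)
    (hc : Adm 2 U S.outVec) (hR : ∀ p ∈ Ioi (0 : ℝ) ×ˢ U, IsUnit (1 + opR S.inVec S.outVec p))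
    (hz : 0 < z) (ha : (y, t) ∈ U) (ζ : ℝ) :
    IntegrableOn (fun η => S.K z η y t * S.Φ η ζ y t) (Ioi z) ∧
      S.Φ z ζ y t + S.K z ζ y t + ∫ η in Ioi z, S.K z η y t * S.Φ η ζ y t = 0 := by
  have h := eqOn_volterra (θ := fun z' y' t' => S.outVec (z', y', t') (S.inVec (ζ, y, t))) hU hb
    (hc.eval_const hU (S.inVec (ζ, y, t))) fun _ _ => rfl
  have hp : (z, y, t) ∈ Ioi (0 : ℝ) ×ˢ U := ⟨hz, ha⟩
  have h1 := h.1 hp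
  have h2 : vol S.xi S.inVec (fun p => S.outVec p (S.inVec (ζ, y, t))) (z, y, t)
    = S.xi (z, y, t) (S.inVec (ζ, y, t)) := vol_xi_eval hU hb hc hR _ hp
  rw [h2] at h1
  simp only [unc, volterra] at h1
  have h3 := h.2 _ hp
  simp only [Φ_eq]
  refine ⟨h3, ?_⟩
  rw [add_right_comm, h1, K_eq z ζ]
  exact add_neg_cancel _

theorem gelfandLevitan_unique [CompleteSpace H] (hU : IsOpen U) (hb : Adm 2 U S.inVec)
    (hc : Adm 2 U S.outVec) (hR : ∀ p ∈ Ioi (0 : ℝ) ×ˢ U, IsUnit (1 + opR S.inVec S.outVec p))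
    (hz : 0 < z) (ha : (y, t) ∈ U) :
    MemLp (fun η => S.K z η y t) 2 (volume.restrict (Ioi z)) ∧
      ∀ k : ℝ → ℂ, MemLp k 2 (volume.restrict (Ioi z)) →
        (∀ ζ : ℝ, z < ζ → S.Φ z ζ y t + k ζ + ∫ η in Ioi z, k η * S.Φ η ζ y t = 0) →
        ∀ ζ : ℝ, z < ζ → k ζ = S.K z ζ y t := by
  have hp : (z, y, t) ∈ Ioi (0 : ℝ) ×ˢ U := ⟨hz, ha⟩
  have hK : MemLp (fun η => S.K z η y t) 2 (volume.restrict (Ioi z)) := by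
    simp only [K_eq]
    exact ((S.xi (z, y, t)).comp_memLp' ((hb 0).memLp hp)).neg
  refine ⟨hK, fun k hk h ζ hζ => ?_⟩
  rw [← sub_eq_zero]
  refine (eq_zero_of_homogeneous hU hb hc hR hp (hk.sub hK) fun ζ hζ => ?_).2 ζ hζ
  have h1 : MemLp (fun η => S.Φ η ζ y t) 2 (volume.restrict (Ioi z)) :=
    (hc.eval_const hU (S.inVec (ζ, y, t)) 0).memLp hp
  have h2 : ∫ η in Ioi z, (k η - S.K z η y t) * S.Φ η ζ y t
      = (∫ η in Ioi z, k η * S.Φ η ζ y t) - ∫ η in Ioi z, S.K z η y t * S.Φ η ζ y t := by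
    simp only [sub_mul]
    exact integral_sub (hk.integrable_mul h1) (hK.integrable_mul h1)
  have h3 := (gelfandLevitan hU hb hc hR hz ha ζ).2
  have h4 := h ζ hζ
  change k ζ - S.K z ζ y t + ∫ η in Ioi z, (k η - S.K z η y t) * S.Φ η ζ y t = 0
  rw [h2]
  linear_combination h4 - h3

end LinearSystemFamily

/-! ### The soliton potential of the linear system -/

namespace LinearSystemFamily

variable {H : Type*} [NormedAddCommGroup H] [InnerProductSpace ℂ H]
  {S : LinearSystemFamily H} {U : Set (ℝ × ℝ)} {α β : ℂ} {φ : ℝ → ℝ → ℝ → ℂ}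

/-- The linear equation of `Φ` in `y`, in terms of the derivatives of `C e^{-zA}` and `B`. -/
def EqY (S : LinearSystemFamily H) (U : Set (ℝ × ℝ)) (β : ℂ) : Prop :=
  ∀ z ζ a, 0 < z → 0 < ζ → a ∈ U →
    (β • pd U ey S.outVec (z, a) + pd U ez (pd U ez S.outVec) (z, a)) (S.inVec (ζ, a))
      = S.outVec (z, a) (pd U ez (pd U ez S.inVec) (ζ, a) - β • pd U ey S.inVec (ζ, a))

/-- The linear equation of `Φ` in `t`, in terms of the derivatives of `C e^{-zA}` and `B`. -/
def EqT (S : LinearSystemFamily H) (U : Set (ℝ × ℝ)) (α : ℂ) : Prop :=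
  ∀ z ζ a, 0 < z → 0 < ζ → a ∈ U →
    (α • pd U et S.outVec (z, a) + pd U ez (pd U ez (pd U ez S.outVec)) (z, a)) (S.inVec (ζ, a))
      = - S.outVec (z, a) (pd U ez (pd U ez (pd U ez S.inVec)) (ζ, a)
          + α • pd U et S.inVec (ζ, a))

theorem eqY_of_Φ (hU : IsOpen U) (hc : Sm U S.outVec) (hb : Sm U S.inVec)
    (hy : ∀ z ζ y t : ℝ, 0 < z → 0 < ζ → (y, t) ∈ U →
      β * deriv (fun y' => S.Φ z ζ y' t) y + iteratedDeriv 2 (fun s => S.Φ s ζ y t) z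
        - iteratedDeriv 2 (fun s => S.Φ z s y t) ζ = 0) : EqY S U β := by
  intro z ζ a hz hζ ha
  have h := hy z ζ a.1 a.2 hz hζ ha
  rw [deriv_Φ_y hU hc hb hz hζ ha, iteratedDeriv_Φ_z hU hc 2 hz ha,
    iteratedDeriv_Φ_ζ hU hb 2 hζ ha] at h
  simp only [Function.iterate_succ, Function.iterate_zero, Function.comp_apply, id] at h
  simp only [add_apply, smul_apply, map_sub, map_smul, smul_eq_mul]
  linear_combination h

theorem eqT_of_Φ (hU : IsOpen U) (hc : Sm U S.outVec) (hb : Sm U S.inVec)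
    (ht : ∀ z ζ y t : ℝ, 0 < z → 0 < ζ → (y, t) ∈ U →
      α * deriv (fun t' => S.Φ z ζ y t') t + iteratedDeriv 3 (fun s => S.Φ s ζ y t) z
        + iteratedDeriv 3 (fun s => S.Φ z s y t) ζ = 0) : EqT S U α := by
  intro z ζ a hz hζ ha
  have h := ht z ζ a.1 a.2 hz hζ ha
  rw [deriv_Φ_t hU hc hb hz hζ ha, iteratedDeriv_Φ_z hU hc 3 hz ha,
    iteratedDeriv_Φ_ζ hU hb 3 hζ ha] at h
  simp only [Function.iterate_succ, Function.iterate_zero, Function.comp_apply, id] at h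
  simp only [add_apply, smul_apply, map_add, map_smul, smul_eq_mul]
  linear_combination h

theorem smoothL2_L₀ (hU : IsOpen U) (hφ : SmoothL2 U φ) : SmoothL2 U (L₀ β φ) := by
  have hφ : Adm 2 U (unc φ) := smoothL2_iff.1 hφ
  exact smoothL2_iff.2 ((hφ.opL₀ hU).congr hU (eqOn_L₀ hU hφ.sm fun _ _ => rfl).symm)

theorem smoothL2_M₀ (hU : IsOpen U) (hφ : SmoothL2 U φ) : SmoothL2 U (M₀ α φ) := by
  have hφ : Adm 2 U (unc φ) := smoothL2_iff.1 hφ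
  exact smoothL2_iff.2 ((hφ.opM₀ hU).congr hU (eqOn_M₀ hU hφ.sm fun _ _ => rfl).symm)

/-- If two functions agree on the domain, then so do their images under `L_u` and `M_u`. -/
theorem eqOn_L_of_eqOn {θ : ℝ → ℝ → ℝ → ℂ} (hU : IsOpen U) (hb : Sm U S.inVec) (hx : Sm U S.xi)
    (hφ : Sm U (unc φ)) (h : EqOn (unc θ) (unc φ) (Ioi (0 : ℝ) ×ˢ U)) :
    EqOn (unc (L β S.u φ)) (unc (L β S.u θ)) (Ioi (0 : ℝ) ×ˢ U) ∧
    EqOn (unc (M α S.u (S.w β) φ)) (unc (M α S.u (S.w β) θ)) (Ioi (0 : ℝ) ×ˢ U) := by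
  have hu := eqOn_u hU hx hb
  have hw := eqOn_w (β := β) hU hx hb
  have hu' := hx.potU hU hb
  exact ⟨(eqOn_L hU hφ (fun _ _ => rfl) hu).trans (eqOn_L hU hφ h hu).symm,
    (eqOn_M hU hφ (fun _ _ => rfl) hu' hu hw).trans (eqOn_M hU hφ h hu' hu hw).symm⟩

theorem eqOn_L₀_M₀ (hU : IsOpen U) (hφ : SmoothOnDomain U φ) :
    EqOn (unc (L₀ β (M₀ α φ))) (unc (M₀ α (L₀ β φ))) (Ioi (0 : ℝ) ×ˢ U) := by
  have hφ : Sm U (unc φ) := hφ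
  have h1 : EqOn (unc φ) (unc φ) (Ioi (0 : ℝ) ×ˢ U) := fun _ _ => rfl
  refine (eqOn_L₀ hU (hφ.opM₀ hU) (eqOn_M₀ hU hφ h1)).trans
    (EqOn.trans ?_ (eqOn_M₀ hU (hφ.opL₀ hU) (eqOn_L₀ hU hφ h1)).symm)
  rw [opL₀_opM₀_comm hU hφ]
  exact fun _ _ => rfl

variable [CompleteSpace H]

theorem smoothL2_volterra (hU : IsOpen U) (hb : Adm 2 U S.inVec) (hx : Adm 2 U S.xi)
    (hφ : SmoothL2 U φ) : SmoothL2 U (volterra S.K φ) := by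
  have hφ : Adm 2 U (unc φ) := smoothL2_iff.1 hφ
  exact smoothL2_iff.2 ((hx.vol hU hb hφ).congr hU
    (eqOn_volterra hU hb hφ fun _ _ => rfl).1.symm)

theorem integrableOn_K_mul (hU : IsOpen U) (hb : Adm 2 U S.inVec) (hφ : SmoothL2 U φ)
    {z y t : ℝ} (hz : 0 < z) (ha : (y, t) ∈ U) :
    IntegrableOn (fun η => S.K z η y t * φ η y t) (Ioi z) := by
  have hφ : Adm 2 U (unc φ) := smoothL2_iff.1 hφ
  exact (eqOn_volterra hU hb hφ fun _ _ => rfl).2 (z, y, t) ⟨hz, ha⟩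

theorem eqOn_L_volterra (hU : IsOpen U) (hb : Adm 2 U S.inVec) (hc : Adm 2 U S.outVec)
    (hR : ∀ p ∈ Ioi (0 : ℝ) ×ˢ U, IsUnit (1 + opR S.inVec S.outVec p)) (hy : EqY S U β)
    (hφ : SmoothL2 U φ) :
    EqOn (unc (L β S.u (volterra S.K φ))) (unc (volterra S.K (L₀ β φ)))
      (Ioi (0 : ℝ) ×ˢ U) := by
  intro p hp
  have hφ : Adm 2 U (unc φ) := smoothL2_iff.1 hφ
  have hx : Adm 2 U S.xi := adm_xi hU hb hc hR
  rw [eqOn_L hU (hx.vol hU hb hφ).sm (eqOn_volterra hU hb hφ fun _ _ => rfl).1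
      (eqOn_u hU hx.sm hb.sm) hp,
    (eqOn_volterra hU hb (hφ.opL₀ hU) (eqOn_L₀ hU hφ.sm fun _ _ => rfl)).1 hp]
  exact opL_vol hU hb hc hR hy hφ hp

theorem eqOn_M_volterra (hU : IsOpen U) (hb : Adm 2 U S.inVec) (hc : Adm 2 U S.outVec)
    (hR : ∀ p ∈ Ioi (0 : ℝ) ×ˢ U, IsUnit (1 + opR S.inVec S.outVec p)) (hy : EqY S U β)
    (ht : EqT S U α) (hφ : SmoothL2 U φ) :
    EqOn (unc (M α S.u (S.w β) (volterra S.K φ))) (unc (volterra S.K (M₀ α φ)))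
      (Ioi (0 : ℝ) ×ˢ U) := by
  intro p hp
  have hφ : Adm 2 U (unc φ) := smoothL2_iff.1 hφ
  have hx : Adm 2 U S.xi := adm_xi hU hb hc hR
  rw [eqOn_M hU (hx.vol hU hb hφ).sm (eqOn_volterra hU hb hφ fun _ _ => rfl).1
      (hx.sm.potU hU hb.sm) (eqOn_u hU hx.sm hb.sm) (eqOn_w hU hx.sm hb.sm) hp,
    (eqOn_volterra hU hb (hφ.opM₀ hU) (eqOn_M₀ hU hφ.sm fun _ _ => rfl)).1 hp]
  exact opM_vol hU hb hc hR hy ht hφ hp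

/-- The inverse of the operator `I + K` of the linear system. -/
noncomputable def volterraInv (S : LinearSystemFamily H) (φ : ℝ → ℝ → ℝ → ℂ) (z y t : ℝ) : ℂ :=
  volInv S.inVec S.outVec (unc φ) (z, y, t)

theorem smoothL2_volterraInv (hU : IsOpen U) (hb : Adm 2 U S.inVec) (hc : Adm 2 U S.outVec)
    (hR : ∀ p ∈ Ioi (0 : ℝ) ×ˢ U, IsUnit (1 + opR S.inVec S.outVec p)) (hφ : SmoothL2 U φ) :
    SmoothL2 U (S.volterraInv φ) :=
  smoothL2_iff.2 (adm_volInv hU hb hc hR (smoothL2_iff.1 hφ))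

theorem eqOn_volterra_volterraInv (hU : IsOpen U) (hb : Adm 2 U S.inVec) (hc : Adm 2 U S.outVec)
    (hR : ∀ p ∈ Ioi (0 : ℝ) ×ˢ U, IsUnit (1 + opR S.inVec S.outVec p)) (hφ : SmoothL2 U φ) :
    EqOn (unc (volterra S.K (S.volterraInv φ))) (unc φ) (Ioi (0 : ℝ) ×ˢ U) := fun _ hp =>
  ((eqOn_volterra hU hb (smoothL2_iff.1 (smoothL2_volterraInv hU hb hc hR hφ))
    fun _ _ => rfl).1 hp).trans (vol_volInv hU hb hc hR (smoothL2_iff.1 hφ) hp)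

theorem eqOn_volterraInv_volterra (hU : IsOpen U) (hb : Adm 2 U S.inVec) (hc : Adm 2 U S.outVec)
    (hR : ∀ p ∈ Ioi (0 : ℝ) ×ˢ U, IsUnit (1 + opR S.inVec S.outVec p)) (hφ : SmoothL2 U φ) :
    EqOn (unc (S.volterraInv (volterra S.K φ))) (unc φ) (Ioi (0 : ℝ) ×ˢ U) := by
  intro p hp
  have hφ : Adm 2 U (unc φ) := smoothL2_iff.1 hφ
  have h1 := (eqOn_volterra hU hb hφ fun _ _ => rfl).1
  have h2 : tail (fun p => unc (volterra S.K φ) p • opX S.inVec S.outVec p (S.inVec p)) p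
      = tail (fun p => vol S.xi S.inVec (unc φ) p • opX S.inVec S.outVec p (S.inVec p)) p :=
    tail_congr (U := U) (fun p hp => by simp only [h1 hp]) hp
  have h3 := volInv_vol hU hb hc hR hφ hp
  rw [volInv] at h3
  rw [unc, volterraInv, volInv, h2, h1 hp]
  exact h3

theorem eqOn_L_M (hU : IsOpen U) (hb : Adm 2 U S.inVec) (hc : Adm 2 U S.outVec)
    (hR : ∀ p ∈ Ioi (0 : ℝ) ×ˢ U, IsUnit (1 + opR S.inVec S.outVec p)) (hy : EqY S U β)
    (ht : EqT S U α) (hφ : SmoothOnDomain U φ) :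
    EqOn (unc (L β S.u (M α S.u (S.w β) φ))) (unc (M α S.u (S.w β) (L β S.u φ)))
      (Ioi (0 : ℝ) ×ˢ U) := by
  have hφ : Sm U (unc φ) := hφ
  have h1 : EqOn (unc φ) (unc φ) (Ioi (0 : ℝ) ×ˢ U) := fun _ _ => rfl
  have hx : Adm 2 U S.xi := adm_xi hU hb hc hR
  have hu := eqOn_u hU hx.sm hb.sm
  have hw := eqOn_w (β := β) hU hx.sm hb.sm
  have hu' := hx.sm.potU hU hb.sm
  have hw' := hx.sm.potW (β := β) hU hb.sm
  have hLφ := eqOn_L (β := β) hU hφ h1 hu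
  have hMφ := eqOn_M (α := α) hU hφ h1 hu' hu hw
  have hLM := eqOn_L (β := β) hU (hu'.opM (α := α) hU hw' hφ) hMφ hu
  have hML := eqOn_M (α := α) hU (hu'.opL (β := β) hU hφ) hLφ hu' hu hw
  refine hLM.trans (EqOn.trans (fun p hp => ?_) hML.symm)
  have h2 := opL_opM_comm (α := α) hU hu' hw' hφ (pd_potW hU hx.sm hb.sm) p
  have h3 : curvature U α β (potU U S.xi S.inVec) (potW U β S.xi S.inVec) p = 0 :=
    curvature_eq_zero hU hb hc hR hy ht hp
  rw [h3, zero_mul] at h2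
  exact sub_eq_zero.1 h2

theorem kpExpr_eq_zero (hU : IsOpen U) (hb : Adm 2 U S.inVec) (hc : Adm 2 U S.outVec)
    (hR : ∀ p ∈ Ioi (0 : ℝ) ×ˢ U, IsUnit (1 + opR S.inVec S.outVec p)) (hy : EqY S U β)
    (ht : EqT S U α) {p : ℝ × ℝ × ℝ} (hp : p ∈ Ioi (0 : ℝ) ×ˢ U) :
    unc (kpExpr α β S.u) p = 0 := by
  have hx : Adm 2 U S.xi := adm_xi hU hb hc hR
  exact (eqOn_kpExpr hU (hx.sm.potU hU hb.sm) (eqOn_u hU hx.sm hb.sm) hp).trans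
    (kp_of_curvature hU (hx.sm.potU hU hb.sm) (hx.sm.potW (β := β) hU hb.sm)
      (pd_potW hU hx.sm hb.sm) (curvature_eq_zero hU hb hc hR hy ht) p)

end LinearSystemFamily

end KP

theorem mainTheorem1 {H : Type*} [NormedAddCommGroup H] [InnerProductSpace ℂ H] [CompleteSpace H]
    (S : KP.LinearSystemFamily H) (U : Set (ℝ × ℝ)) (hU : IsOpen U) (α β : ℂ)
    (hC : KP.SmoothL2 U S.out) (hB : KP.SmoothL2 U S.B)
    (hR : ∀ z y t : ℝ, 0 < z → (y, t) ∈ U → IsUnit (1 + S.R z y t))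
    (hy : ∀ z ζ y t : ℝ, 0 < z → 0 < ζ → (y, t) ∈ U →
      β * deriv (fun y' => S.Φ z ζ y' t) y + iteratedDeriv 2 (fun s => S.Φ s ζ y t) z
        - iteratedDeriv 2 (fun s => S.Φ z s y t) ζ = 0)
    (ht : ∀ z ζ y t : ℝ, 0 < z → 0 < ζ → (y, t) ∈ U →
      α * deriv (fun t' => S.Φ z ζ y t') t + iteratedDeriv 3 (fun s => S.Φ s ζ y t) z
        + iteratedDeriv 3 (fun s => S.Φ z s y t) ζ = 0) :
    -- the kernel and the potentials are smooth
    ContDiffOn ℝ ∞ (fun p : ℝ × ℝ × ℝ × ℝ => S.K p.1 p.2.1 p.2.2.1 p.2.2.2)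
      (Ioi (0 : ℝ) ×ˢ Ioi (0 : ℝ) ×ˢ U) ∧
    KP.SmoothOnDomain U S.u ∧ KP.SmoothOnDomain U (S.w β) ∧
    -- `K` solves the Gelfand-Levitan equation, and is its only square-integrable solution
    (∀ z ζ y t : ℝ, 0 < z → 0 < ζ → (y, t) ∈ U →
      IntegrableOn (fun η => S.K z η y t * S.Φ η ζ y t) (Ioi z) ∧
      S.Φ z ζ y t + S.K z ζ y t + ∫ η in Ioi z, S.K z η y t * S.Φ η ζ y t = 0) ∧
    (∀ z y t : ℝ, 0 < z → (y, t) ∈ U →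
      MemLp (fun η => S.K z η y t) 2 (volume.restrict (Ioi z)) ∧
      ∀ k : ℝ → ℂ, MemLp k 2 (volume.restrict (Ioi z)) →
        (∀ ζ : ℝ, z < ζ → S.Φ z ζ y t + k ζ + ∫ η in Ioi z, k η * S.Φ η ζ y t = 0) →
        ∀ ζ : ℝ, z < ζ → k ζ = S.K z ζ y t) ∧
    -- `L₀`, `M₀` and `I + K` act on the smooth functions with square-integrable derivatives
    (∀ φ : ℝ → ℝ → ℝ → ℂ, KP.SmoothL2 U φ →
      KP.SmoothL2 U (KP.L₀ β φ) ∧ KP.SmoothL2 U (KP.M₀ α φ) ∧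
      KP.SmoothL2 U (KP.volterra S.K φ) ∧
      ∀ z y t : ℝ, 0 < z → (y, t) ∈ U →
        IntegrableOn (fun η => S.K z η y t * φ η y t) (Ioi z)) ∧
    -- `L_u (I + K) = (I + K) L₀` and `M_u (I + K) = (I + K) M₀`
    (∀ φ : ℝ → ℝ → ℝ → ℂ, KP.SmoothL2 U φ →
      KP.EqOnDomain U (KP.L β S.u (KP.volterra S.K φ)) (KP.volterra S.K (KP.L₀ β φ)) ∧
      KP.EqOnDomain U (KP.M α S.u (S.w β) (KP.volterra S.K φ))
        (KP.volterra S.K (KP.M₀ α φ))) ∧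
    -- `I + K` is invertible, and conjugation by it takes `(L₀, M₀)` to `(L_u, M_u)`
    (∃ J : (ℝ → ℝ → ℝ → ℂ) → (ℝ → ℝ → ℝ → ℂ), ∀ φ : ℝ → ℝ → ℝ → ℂ, KP.SmoothL2 U φ →
      KP.SmoothL2 U (J φ) ∧
      KP.EqOnDomain U (KP.volterra S.K (J φ)) φ ∧
      KP.EqOnDomain U (J (KP.volterra S.K φ)) φ ∧
      KP.EqOnDomain U (KP.L β S.u φ) (KP.volterra S.K (KP.L₀ β (J φ))) ∧
      KP.EqOnDomain U (KP.M α S.u (S.w β) φ) (KP.volterra S.K (KP.M₀ α (J φ)))) ∧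
    -- both pairs commute
    (∀ φ : ℝ → ℝ → ℝ → ℂ, KP.SmoothOnDomain U φ →
      KP.EqOnDomain U (KP.L₀ β (KP.M₀ α φ)) (KP.M₀ α (KP.L₀ β φ)) ∧
      KP.EqOnDomain U (KP.L β S.u (KP.M α S.u (S.w β) φ))
        (KP.M α S.u (S.w β) (KP.L β S.u φ))) ∧
    -- `u` satisfies the KP equation
    (∀ z y t : ℝ, 0 < z → (y, t) ∈ U → KP.kpExpr α β S.u z y t = 0) := by
  have hb := KP.LinearSystemFamily.adm_inVec hU hB
  have hc := KP.LinearSystemFamily.adm_outVec hC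
  have hR' := KP.LinearSystemFamily.isUnit_one_add_opR hR
  have hx : KP.Adm 2 U S.xi := KP.adm_xi hU hb hc hR'
  have hy' := KP.LinearSystemFamily.eqY_of_Φ hU hc.sm hb.sm hy
  have ht' := KP.LinearSystemFamily.eqT_of_Φ hU hc.sm hb.sm ht
  have hLK := fun φ (hφ : KP.SmoothL2 U φ) =>
    KP.LinearSystemFamily.eqOn_L_volterra hU hb hc hR' hy' hφ
  have hMK := fun φ (hφ : KP.SmoothL2 U φ) =>
    KP.LinearSystemFamily.eqOn_M_volterra hU hb hc hR' hy' ht' hφ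
  refine ⟨KP.LinearSystemFamily.contDiffOn_K hx.sm hb.sm,
    KP.sm_of_eqOn (hx.sm.potU hU hb.sm) (KP.LinearSystemFamily.eqOn_u hU hx.sm hb.sm),
    KP.sm_of_eqOn (hx.sm.potW hU hb.sm) (KP.LinearSystemFamily.eqOn_w hU hx.sm hb.sm),
    fun z ζ y t hz _ ha => KP.LinearSystemFamily.gelfandLevitan hU hb hc hR' hz ha ζ,
    fun z y t hz ha => KP.LinearSystemFamily.gelfandLevitan_unique hU hb hc hR' hz ha,
    fun φ hφ => ⟨KP.LinearSystemFamily.smoothL2_L₀ hU hφ, KP.LinearSystemFamily.smoothL2_M₀ hU hφ,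
      KP.LinearSystemFamily.smoothL2_volterra hU hb hx hφ, fun z y t hz ha =>
        KP.LinearSystemFamily.integrableOn_K_mul hU hb hφ hz ha⟩,
    fun φ hφ => ⟨KP.eqOnDomain_of_eqOn (hLK φ hφ), KP.eqOnDomain_of_eqOn (hMK φ hφ)⟩,
    ⟨S.volterraInv, fun φ hφ => ?_⟩,
    fun φ hφ => ⟨KP.eqOnDomain_of_eqOn (KP.LinearSystemFamily.eqOn_L₀_M₀ hU hφ),
      KP.eqOnDomain_of_eqOn (KP.LinearSystemFamily.eqOn_L_M hU hb hc hR' hy' ht' hφ)⟩,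
    fun z y t hz ha => KP.LinearSystemFamily.kpExpr_eq_zero (p := (z, y, t)) hU hb hc hR' hy' ht'
      ⟨hz, ha⟩⟩
  have hJ := KP.LinearSystemFamily.smoothL2_volterraInv hU hb hc hR' hφ
  have hVJ := KP.LinearSystemFamily.eqOn_volterra_volterraInv hU hb hc hR' hφ
  have hJV := KP.LinearSystemFamily.eqOn_volterraInv_volterra hU hb hc hR' hφ
  have h := KP.LinearSystemFamily.eqOn_L_of_eqOn (α := α) (β := β) hU hb.sm hx.sm hφ.1 hVJ
  have hL := h.1.trans (hLK _ hJ)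
  have hM := h.2.trans (hMK _ hJ)
  exact ⟨hJ, KP.eqOnDomain_of_eqOn hVJ, KP.eqOnDomain_of_eqOn hJV, KP.eqOnDomain_of_eqOn hL,
    KP.eqOnDomain_of_eqOn hM⟩
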